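/- **Setting.** Fix positive integers $a$ and $d$. A *rooted directed tree* is a directed graph $(V,\mathcal E)$ with a vertex $\mathsf{root}$ that has no parent, such that every other vertex has exactly one parent and is reachable from $\mathsf{root}$ by a directed path. $\mathrm{Chi}(v)$ is the set of children of $v$, the depth $\mathsf d_v\in\mathbb N$ is the number of edges from $\mathsf{root}$ to $v$, and $v$ is *branching* if it has at least two children. All trees below are countably infinite, leafless (every vertex has a child), locally finite (every vertex has finitely many children) and of *finite branching index* (the depths of the branching vertices are bounded). The *directed Cartesian product* $\mathscr T=(V,\mathcal E)$ of $\mathscr T_j=(V_j,\mathcal E_j)$, $1\le j\le d$, has $V=V_1\times\cdots\times V_d$, and $(v,w)\in\mathcal E$ iff for some $k$ one has $(v_k,w_k)\in\mathcal E_k$ and $v_j=w_j$ for $j\ne k$. Two directed graphs are isomorphic if there is a bijection of the vertices that preserves directed edges in both directions. For $v\in V$ put $\mathsf d_v=(\mathsf d_{v_1},\dots,\mathsf d_{v_d})\in\mathbb N^d$ and $|\mathsf d_v|=\sum_j\mathsf d_{v_j}$; $\mathrm{Chi}_j(v)$ is the set of the vertices obtained from $v$ by replacing $v_j$ by one of its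 children, and $\mathrm{par}_j(w)$ is obtained from $w$ (with $w_j\ne\mathsf{root}_j$) by replacing $w_j$ by its parent. Let $\mathfrak c_a(t)=\frac{t+d}{t+a}$ and, for $w\in\mathrm{Chi}_j(v)$, $$\lambda_j(w)=\sqrt{\frac{\mathfrak c_a(|\mathsf d_v|)}{\mathrm{card}\,\mathrm{Chi}_j(v)}}\sqrt{\frac{\mathsf d_{v_j}+1}{|\mathsf d_v|+d}} .$$ Define bounded operators $S_1,\dots,S_d$ on $l^2(V)$ by $(S_jf)(w)=\lambda_j(w)f(\mathrm{par}_j(w))$ if $w_j\neq\mathsf{root}_j$ and $(S_jf)(w)=0$ otherwise, and put $E=\bigcap_{j}\ker S_j^*$. For $F\subseteq\{1,\dots,d\}$ let $\Phi_F=\{v\in V: v_j\ne\mathsf{root}_j\Leftrightarrow j\in F\}$; for $u\in\Phi_F$ let $\mathsf{sib}_F(u)$ be the set of $v\in\Phi_F$ such that $v_j$ and $u_j$ have the same parent for all $j\in F$; let $\Omega_F$ contain exactly one element of each of the classes $\mathsf{sib}_F(u)$, $u\in\Phi_F$. Let $\mathcal L_{u,F}\subseteq E$ be the space of the $f\in l^2(V)$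 supported on $\mathsf{sib}_F(u)$ with $\sum_w f(w)\lambda_j(w)=0$ for all $j\in F$ and $v\in\mathsf{sib}_F(u)$, where $w$ runs over the vertices obtained from $v$ by replacing $v_j$ by any vertex with the same parent as $u_j$. Let $P_{\mathcal L_{u,F}}\in B(E)$ be the orthogonal projection onto $\mathcal L_{u,F}$. The *Drury–Arveson-type Hilbert module* $\mathscr H_{\mathfrak c_a}(\mathscr T)$ is the reproducing kernel Hilbert space of $E$-valued functions on the open unit ball $\mathbb B^d$ of $\mathbb C^d$ with the kernel $$\kappa(z,w)=\sum_{F\subseteq\{1,\dots,d\}}\ \sum_{u\in\Omega_F}\Big(\sum_{\alpha\in\mathbb N^d}\frac{\mathsf d_u!}{(\mathsf d_u+\alpha)!}\prod_{j=0}^{|\alpha|-1}(|\mathsf d_u|+a+j)\;z^\alpha\overline w^\alpha\Big)P_{\mathcal L_{u,F}},$$ together with the bounded operators $\mathscr M_{z_1},\dots,\mathscr M_{z_d}$ of multiplication by the coordinate functions. Two such modules are *isomorphic* if there is a unitary map $U$ between them such that $U\mathscr M_{z_k}=\mathscr M_{z_k}U$ for $k=1,\dots,d$. **Corollary.** Let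 $a,d$ be positive integers. 1. There are infinitely many mutually non-isomorphic Drury–Arveson-type Hilbert modules: there is a sequence $\mathscr T^{(0)},\mathscr T^{(1)},\dots$ of directed Cartesian products of $d$ trees as above such that $\mathscr H_{\mathfrak c_a}(\mathscr T^{(m)})$ and $\mathscr H_{\mathfrak c_a}(\mathscr T^{(n)})$ are not isomorphic for $m\ne n$. 2. For every positive integer $k$ there are $k$ mutually non-isomorphic (as directed graphs) directed Cartesian products $\mathscr T^{(1)},\dots,\mathscr T^{(k)}$ of $d$ trees as above such that the Hilbert modules $\mathscr H_{\mathfrak c_a}(\mathscr T^{(1)}),\dots,\mathscr H_{\mathfrak c_a}(\mathscr T^{(k)})$ are all isomorphic. -/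

import Mathlib

noncomputable section

namespace DruryArveson

/-- A rooted directed tree: a directed graph with a root which has no parent, in which every other
vertex has exactly one parent and every vertex can be reached from the root by a directed path.
(These properties exclude loops and circuits.) -/
structure RootedDirectedTree where
  /-- the vertices -/
  V : Type
  /-- `Adj u v` means that `(u, v)` is a directed edge -/
  Adj : V → V → Prop
  /-- the root -/
  root : V
  not_adj_root : ∀ u, ¬ Adj u root
  existsUnique_parent : ∀ v, v ≠ root → ∃! u, Adj u v
  reachable : ∀ v, Relation.ReflTransGen Adj root v

namespace RootedDirectedTree

variable (T : RootedDirectedTree)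

/-- The set `Chi(v)` of children of a vertex. -/
def children (v : T.V) : Set T.V := {w | T.Adj v w}

open scoped Classical in
/-- The parent of a vertex (the root, which has no parent, is sent to itself). -/
def parent (v : T.V) : T.V := if h : ∃ u, T.Adj u v then h.choose else v

/-- The `n`-th generation: the vertices `n` steps below the root. -/
def generation : ℕ → Set T.V
  | 0 => {T.root}
  | n + 1 => {w | ∃ v ∈ generation n, T.Adj v w}

/-- The depth of a vertex: the (only) `n` such that the vertex belongs to the `n`-th generation. -/
def depth (v : T.V) : ℕ := sInf {n | v ∈ T.generation n}

/-- The branching vertices: those with at least two children. -/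
def branching : Set T.V := {v | (T.children v).Nontrivial}

/-- The branching index: `1 + sup {depth w : w branching}`, or `0` if no vertex is branching. -/
def branchingIndex : ℕ∞ := ⨆ w ∈ T.branching, ((T.depth w : ℕ∞) + 1)

end RootedDirectedTree

/-- The data of a directed Cartesian product of `d` rooted directed trees, each of them countably
infinite, leafless, locally finite and of finite branching index. -/
structure TreeProduct (d : ℕ) where
  /-- the factors -/
  tree : Fin d → RootedDirectedTree
  countable : ∀ j, Countable (tree j).V
  infinite : ∀ j, Infinite (tree j).V
  leafless : ∀ j v, ((tree j).children v).Nonempty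
  locallyFinite : ∀ j v, ((tree j).children v).Finite
  finite_branchingIndex : ∀ j, (tree j).branchingIndex < ⊤

namespace TreeProduct

variable {d : ℕ} (T : TreeProduct d)

/-- The vertices of the directed Cartesian product. -/
abbrev Vert : Type := ∀ j, (T.tree j).V

/-- The edges of the directed Cartesian product. -/
def Adj (v w : T.Vert) : Prop :=
  ∃ k, (∀ j, j ≠ k → v j = w j) ∧ (T.tree k).Adj (v k) (w k)

/-- Isomorphism of directed graphs: a bijection between the vertices that preserves edges (in both
directions). -/
def GraphIso (T' : TreeProduct d) : Prop := Nonempty (T.Adj ≃r T'.Adj)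

/-- The finite set of children of a vertex of the `j`-th factor. -/
def childFinset (j : Fin d) (x : (T.tree j).V) : Finset (T.tree j).V :=
  (T.locallyFinite j x).toFinset

/-- The depth of a vertex of the product, a multiindex. -/
def depth (v : T.Vert) : Fin d → ℕ := fun j => (T.tree j).depth (v j)

/-- `par_j(v)`: replace the `j`-th coordinate by its parent. -/
def par (j : Fin d) (v : T.Vert) : T.Vert := Function.update v j ((T.tree j).parent (v j))

/-- The sequence `c_a(t) = (t + d) / (t + a)`. -/
def cSeq (d a t : ℕ) : ℝ := ((t : ℝ) + d) / (t + a)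

/-- The weights of the Drury-Arveson-type multishift. For `w ∈ Chi_j(v)`, that is `v = par_j(w)`
with `w j ≠ root`,
`λ_j(w) = √(c_a(|d_v|) / card Chi_j(v)) * √((d_{v_j} + 1) / (|d_v| + d))`. -/
def weight (a : ℕ) (j : Fin d) (w : T.Vert) : ℝ :=
  let v := T.par j w
  √(cSeq d a (∑ i, T.depth v i) / (T.childFinset j (v j)).card) *
    √(((T.depth v j : ℝ) + 1) / ((∑ i, T.depth v i : ℕ) + d))

/-- The Hilbert space `l²(V)`. -/
abbrev L2 : Type := lp (fun _ : T.Vert => ℂ) 2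

open scoped Classical in
/-- The transformation `Λ_j` of the functions on `V` that underlies the multishift. -/
def shiftFun (a : ℕ) (j : Fin d) (f : T.Vert → ℂ) : T.Vert → ℂ := fun w =>
  if w j ≠ (T.tree j).root then (T.weight a j w : ℂ) * f (T.par j w) else 0

lemma adj_parent (S : RootedDirectedTree) (x : S.V) (hx : x ≠ S.root) : S.Adj (S.parent x) x := by
  have h : ∃ u, S.Adj u x := (S.existsUnique_parent x hx).exists
  rw [RootedDirectedTree.parent, dif_pos h]
  exact h.choose_spec

lemma cSeq_le (d a t : ℕ) : cSeq d a t ≤ d + 1 := by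
  unfold cSeq
  rcases Nat.eq_zero_or_pos (t + a) with h | h
  · have h' : (t : ℝ) + a = 0 := by exact_mod_cast h
    rw [h', div_zero]; positivity
  · have h' : (1 : ℝ) ≤ (t : ℝ) + a := by exact_mod_cast h
    rw [div_le_iff₀ (by linarith)]
    have ha : (0 : ℝ) ≤ a := by positivity
    nlinarith [mul_nonneg (Nat.cast_nonneg (α := ℝ) d) (sub_nonneg.2 h')]

/-- The weights of the children of `v` in the direction `j` are uniformly square summable. -/
lemma sum_weight_sq_le (a : ℕ) (j : Fin d) (v : T.Vert) (s : Finset T.Vert)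
    (hs : ∀ w ∈ s, w j ≠ (T.tree j).root ∧ T.par j w = v) :
    ∑ w ∈ s, (T.weight a j w) ^ 2 ≤ d + 1 := by
  classical
  set n := (T.childFinset j (v j)).card with hn
  have hcard : s.card ≤ n := by
    refine Finset.card_le_card_of_injOn (fun w => w j) ?_ ?_
    · intro w hw
      obtain ⟨h1, h2⟩ := hs w hw
      have h3 := adj_parent (T.tree j) (w j) h1
      have h4 : v j = (T.tree j).parent (w j) := by rw [← h2]; simp [par]
      simp only [childFinset, Set.Finite.coe_toFinset, RootedDirectedTree.children,
        Set.mem_ofPred_eq, h4]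
      exact h3
    · intro w hw w' hw' h
      obtain ⟨-, h2⟩ := hs w hw
      obtain ⟨-, h2'⟩ := hs w' hw'
      funext i
      by_cases hi : i = j
      · subst hi; exact h
      · have e : T.par j w i = T.par j w' i := by rw [h2, h2']
        simpa [par, hi] using e
  set q : ℝ := ((T.depth v j : ℝ) + 1) / ((∑ i, T.depth v i : ℕ) + d) with hq
  have hc0 : 0 ≤ cSeq d a (∑ i, T.depth v i) := by unfold cSeq; positivity
  have hq0 : 0 ≤ q := by rw [hq]; positivity
  have hd1 : (1 : ℝ) ≤ d := by exact_mod_cast Fin.pos j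
  have hq1 : q ≤ 1 := by
    rw [hq]
    apply div_le_one_of_le₀ _ (by positivity)
    have : T.depth v j ≤ ∑ i, T.depth v i :=
      Finset.single_le_sum (f := T.depth v) (fun _ _ => Nat.zero_le _) (Finset.mem_univ j)
    have : (T.depth v j : ℝ) ≤ (∑ i, T.depth v i : ℕ) := by exact_mod_cast this
    linarith
  have hw : ∀ w ∈ s, (T.weight a j w) ^ 2 = cSeq d a (∑ i, T.depth v i) / n * q := by
    intro w hw
    obtain ⟨-, h2⟩ := hs w hw
    simp only [weight, h2]
    rw [mul_pow, Real.sq_sqrt (by positivity), Real.sq_sqrt (by positivity)]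
  rw [Finset.sum_congr rfl hw, Finset.sum_const, nsmul_eq_mul]
  have hc1 := cSeq_le d a (∑ i, T.depth v i)
  have hcn : (s.card : ℝ) * (cSeq d a (∑ i, T.depth v i) / n) ≤ d + 1 := by
    rcases Nat.eq_zero_or_pos n with h0 | h0
    · rw [h0]; simp; positivity
    · have h0' : (0 : ℝ) < n := by exact_mod_cast h0
      have hcard' : (s.card : ℝ) ≤ n := by exact_mod_cast hcard
      calc (s.card : ℝ) * (cSeq d a (∑ i, T.depth v i) / n)
          ≤ n * (cSeq d a (∑ i, T.depth v i) / n) := by gcongr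
        _ = cSeq d a (∑ i, T.depth v i) := by field_simp
        _ ≤ d + 1 := hc1
  calc (s.card : ℝ) * (cSeq d a (∑ i, T.depth v i) / n * q)
      = ((s.card : ℝ) * (cSeq d a (∑ i, T.depth v i) / n)) * q := by ring
    _ ≤ (d + 1) * 1 := by gcongr
    _ = d + 1 := by ring

lemma sum_norm_shiftFun_sq_le (a : ℕ) (j : Fin d) (f : T.L2) (s : Finset T.Vert) :
    ∑ w ∈ s, ‖T.shiftFun a j f w‖ ^ 2 ≤ (d + 1) * ‖f‖ ^ 2 := by
  classical
  have key : ∀ t : Finset T.Vert, ∑ v ∈ t, ‖f v‖ ^ 2 ≤ ‖f‖ ^ 2 := by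
    intro t
    have := lp.sum_rpow_le_norm_rpow (p := 2) (by norm_num) f t
    simpa using this
  have h1 : ∑ w ∈ s, ‖T.shiftFun a j f w‖ ^ 2 =
      ∑ w ∈ s with w j ≠ (T.tree j).root, (T.weight a j w) ^ 2 * ‖f (T.par j w)‖ ^ 2 := by
    rw [Finset.sum_filter]
    refine Finset.sum_congr rfl fun w _ => ?_
    unfold shiftFun
    split_ifs
    · rw [norm_mul, mul_pow, Complex.norm_real, Real.norm_eq_abs, sq_abs]
    · simp
  rw [h1, ← Finset.sum_fiberwise_of_maps_to (t := s.image (T.par j)) (g := T.par j)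
    (fun w hw => Finset.mem_image_of_mem _ (Finset.mem_filter.1 hw).1)]
  calc _ ≤ ∑ v ∈ s.image (T.par j), ((d : ℝ) + 1) * ‖f v‖ ^ 2 := by
        refine Finset.sum_le_sum fun v _ => ?_
        rw [Finset.sum_congr rfl (g := fun w => (T.weight a j w) ^ 2 * ‖f v‖ ^ 2)
          (fun w hw => by rw [(Finset.mem_filter.1 hw).2]), ← Finset.sum_mul]
        gcongr
        refine T.sum_weight_sq_le a j v _ fun w hw => ?_
        simp only [Finset.mem_filter] at hw
        exact ⟨hw.1.2, hw.2⟩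
    _ = (d + 1) * ∑ v ∈ s.image (T.par j), ‖f v‖ ^ 2 := by rw [Finset.mul_sum]
    _ ≤ _ := by gcongr; exact key _

lemma memℓp_shiftFun (a : ℕ) (j : Fin d) (f : T.L2) : Memℓp (T.shiftFun a j f) 2 := by
  refine memℓp_gen' (C := (d + 1) * ‖f‖ ^ 2) fun s => ?_
  simpa using T.sum_norm_shiftFun_sq_le a j f s

/-- The `j`-th operator `S_j` of the Drury-Arveson-type multishift, a bounded operator on
`l²(V)`. -/
def shift (a : ℕ) (j : Fin d) : T.L2 →L[ℂ] T.L2 :=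
  LinearMap.mkContinuous
    { toFun := fun f => ⟨T.shiftFun a j f, T.memℓp_shiftFun a j f⟩
      map_add' := fun f g => by
        ext w
        simp only [shiftFun, lp.coeFn_add, Pi.add_apply]
        split_ifs <;> ring
      map_smul' := fun c f => by
        ext w
        simp only [shiftFun, lp.coeFn_smul, Pi.smul_apply, smul_eq_mul, RingHom.id_apply]
        split_ifs <;> ring }
    (√(d + 1)) (fun f => by
      refine lp.norm_le_of_forall_sum_le (by norm_num) (by positivity) fun s => ?_
      have := T.sum_norm_shiftFun_sq_le a j f s
      simpa [mul_pow, Real.sq_sqrt (show (0 : ℝ) ≤ (d : ℝ) + 1 by positivity)] using this)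

/-- The joint cokernel `E = ⋂_j ker S_j^*` of the multishift. -/
def E (a : ℕ) : Submodule ℂ T.L2 := ⨅ j, (ContinuousLinearMap.adjoint (T.shift a j)).ker

lemma isClosed_E (a : ℕ) : IsClosed (T.E a : Set T.L2) := by
  simp only [E, Submodule.coe_iInf]
  exact isClosed_iInter fun j => ContinuousLinearMap.isClosed_ker _

instance (a : ℕ) : CompleteSpace (T.E a) := (T.isClosed_E a).completeSpace_coe

/-- `Φ_F`: the vertices whose coordinate `j` differs from the root exactly for `j ∈ F`. -/
def Phi (F : Finset (Fin d)) : Set T.Vert := {v | ∀ j, v j ≠ (T.tree j).root ↔ j ∈ F}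

/-- `sib_F(u)` for `u ∈ Φ_F`: the vertices of `Φ_F` whose coordinate `j` is a sibling of `u j`
(that is, has the same parent) for each `j ∈ F`. -/
def sib (F : Finset (Fin d)) (u : T.Vert) : Set T.Vert :=
  {v | v ∈ T.Phi F ∧ ∀ j ∈ F, (T.tree j).parent (v j) = (T.tree j).parent (u j)}

/-- The equivalence relation `u ∼ v ↔ u ∈ sib_F(v)` on `Φ_F`. -/
def sibSetoid (F : Finset (Fin d)) : Setoid (T.Phi F) where
  r u v := (u : T.Vert) ∈ T.sib F v
  iseqv :=
    { refl := fun u => ⟨u.2, fun _ _ => rfl⟩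
      symm := fun {_ v} h => ⟨v.2, fun j hj => (h.2 j hj).symm⟩
      trans := fun {u _ _} h h' => ⟨u.2, fun j hj => (h.2 j hj).trans (h'.2 j hj)⟩ }

/-- The indexing set `Ω_F`: one (chosen) element from each of the classes `sib_F(u)`,
`u ∈ Φ_F`. -/
def Omega (F : Finset (Fin d)) : Set T.Vert :=
  Set.range fun q : Quotient (T.sibSetoid F) => ((Quotient.out q : T.Phi F) : T.Vert)

/-- The space `L_{u,F}`, as a subspace of `E`: the functions supported on `sib_F(u)` that satisfy
`∑ f(w) λ_j(w) = 0` for all `j ∈ F` and `v ∈ sib_F(u)`, where `w` runs over the vertices obtained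
from `v` when the coordinate `j` is replaced by any sibling `η` of `u j`. -/
def L (a : ℕ) (F : Finset (Fin d)) (u : T.Vert) : Submodule ℂ (T.E a) where
  carrier := {f | (∀ w, w ∉ T.sib F u → (f : T.L2) w = 0) ∧
    ∀ j ∈ F, ∀ v ∈ T.sib F u, ∑ η ∈ T.childFinset j ((T.tree j).parent (u j)),
      (f : T.L2) (Function.update v j η) * (T.weight a j (Function.update v j η) : ℂ) = 0}
  zero_mem' := by simp
  add_mem' := by
    rintro f g ⟨hf, hf'⟩ ⟨hg, hg'⟩
    refine ⟨fun w hw => by simp [hf w hw, hg w hw], fun j hj v hv => ?_⟩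
    simp [add_mul, Finset.sum_add_distrib, hf' j hj v hv, hg' j hj v hv]
  smul_mem' := by
    rintro c f ⟨hf, hf'⟩
    refine ⟨fun w hw => by simp [hf w hw], fun j hj v hv => ?_⟩
    simp [mul_assoc, ← Finset.mul_sum, hf' j hj v hv]

lemma isClosed_L (a : ℕ) (F : Finset (Fin d)) (u : T.Vert) :
    IsClosed (T.L a F u : Set (T.E a)) := by
  classical
  have hev : ∀ w : T.Vert, Continuous fun f : T.E a => (f : T.L2) w := fun w =>
    (lp.evalCLM ℂ (fun _ : T.Vert => ℂ) 2 w).continuous.comp continuous_subtype_val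
  have e : (T.L a F u : Set (T.E a)) =
      (⋂ w, ⋂ (_ : w ∉ T.sib F u), {f : T.E a | (f : T.L2) w = 0}) ∩
      ⋂ j, ⋂ (_ : j ∈ F), ⋂ v, ⋂ (_ : v ∈ T.sib F u),
        {f : T.E a | ∑ η ∈ T.childFinset j ((T.tree j).parent (u j)),
          (f : T.L2) (Function.update v j η) *
            (T.weight a j (Function.update v j η) : ℂ) = 0} := by
    ext f
    simp [L]
  rw [e]
  refine IsClosed.inter ?_ ?_
  · exact isClosed_iInter fun w => isClosed_iInter fun _ => isClosed_eq (hev w) continuous_const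
  · exact isClosed_iInter fun j => isClosed_iInter fun _ => isClosed_iInter fun v =>
      isClosed_iInter fun _ => isClosed_eq
        (continuous_finsetSum _ fun η _ => (hev _).mul continuous_const) continuous_const

instance (a : ℕ) (F : Finset (Fin d)) (u : T.Vert) : CompleteSpace (T.L a F u) :=
  (T.isClosed_L a F u).completeSpace_coe

end TreeProduct

/-- The open unit ball of `ℂ^d`, with the Euclidean norm. -/
abbrev UnitBall (d : ℕ) : Type := Metric.ball (0 : EuclideanSpace ℂ (Fin d)) 1

/-- The monomial `z^α`. -/
def monomial {d : ℕ} (z : UnitBall d) (α : Fin d → ℕ) : ℂ :=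
  ∏ i, (z : EuclideanSpace ℂ (Fin d)) i ^ α i

/-- The multiindex factorial `α!`. -/
def mfactorial {d : ℕ} (α : Fin d → ℕ) : ℕ := ∏ i, (α i).factorial

/-- The scalar kernel
`∑_α δ! / (δ + α)! * (∏_{j < |α|} (|δ| + a + j)) z^α conj(w)^α` on the unit ball. -/
def scalarKernel {d : ℕ} (a : ℕ) (δ : Fin d → ℕ) (z w : UnitBall d) : ℂ :=
  ∑' α : Fin d → ℕ, ((mfactorial δ : ℂ) / (mfactorial (δ + α) : ℂ)) *
    (∏ j ∈ Finset.range (∑ i, α i), (((∑ i, δ i : ℕ) : ℂ) + a + j)) *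
    monomial z α * (starRingEnd ℂ) (monomial w α)

/-- The operator-valued kernel on the unit ball
`κ(z, w) = ∑_F ∑_{u ∈ Ω_F} k_{d_u}(z, w) P_{L_{u,F}}`, where `k_δ` is the scalar kernel and
`P` denotes orthogonal projections in `E`. -/
def TreeProduct.kernel {d : ℕ} (T : TreeProduct d) (a : ℕ) :
    Matrix (UnitBall d) (UnitBall d) (T.E a →L[ℂ] T.E a) :=
  Matrix.of fun z w => ∑ F : Finset (Fin d), ∑' u : T.Omega F,
    scalarKernel a (T.depth u) z w • (T.L a F u).starProjection

/-- The Drury-Arveson-type Hilbert module of `T`: the reproducing kernel Hilbert space of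
`E`-valued functions on the unit ball with the kernel `κ`, with the operators `M_{z_k}` of
multiplication by the coordinate functions. A reproducing kernel Hilbert space is determined by its
kernel (as a space of functions, with its inner product), and `M` is determined by `M_apply`; so
there is at most one such module up to canonical isomorphism. -/
structure HilbertModule {d : ℕ} (a : ℕ) (T : TreeProduct d) where
  /-- the underlying space -/
  H : Type
  [normed : NormedAddCommGroup H]
  [inner : InnerProductSpace ℂ H]
  [complete : CompleteSpace H]
  [rkhs : RKHS ℂ H (UnitBall d) (T.E a)]
  kernel_eq : RKHS.kernel H = T.kernel a
  /-- the multiplication operators -/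
  M : Fin d → H →L[ℂ] H
  M_apply : ∀ (k : Fin d) (f : H) (z : UnitBall d),
    M k f z = (z : EuclideanSpace ℂ (Fin d)) k • f z

attribute [instance] HilbertModule.normed HilbertModule.inner HilbertModule.complete
  HilbertModule.rkhs

/-- Isomorphism of Hilbert modules: a unitary map that intertwines the multiplication operators. -/
def HilbertModule.Iso {d a : ℕ} {T T' : TreeProduct d} (X : HilbertModule a T)
    (Y : HilbertModule a T') : Prop :=
  ∃ U : X.H ≃ₗᵢ[ℂ] Y.H, ∀ (k : Fin d) (f : X.H), U (X.M k f) = Y.M k (U f)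

end DruryArveson

end

/-!
The functions `f ∈ E` are those whose sums over all the sets `Chi_j(v)` vanish, and `E` is the
orthogonal sum of its homogeneous parts `E_δ`, the functions in `E` supported on the vertices of
depth `δ`. The kernel multiplies `E_δ` by the scalar kernel `k_δ`, so the Hilbert module is the
orthogonal sum, over all `δ`, of `dim E_δ` copies of the space with the kernel `k_δ`. Hence it is
determined up to isomorphism by the Hilbert function `δ ↦ dim E_δ`, while the joint cokernel of
its multiplication operators has the dimension of `E`.

Summing over the children in the `j`-th direction maps the functions supported on depth `δ + e_j`
onto those supported on depth `δ`, and the sums in different directions commute. Thus `dim E_δ` is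
the product over `j` of the increments at `δ_j` of the sizes of the generations of `T_j`, and
`dim E` is the product of the eventual sizes of the generations. Trees with more and more rays
therefore give pairwise non-isomorphic modules. On the other hand, for a tree whose root has two
children, moving rays from one child to the other changes the out-degrees, but not the sizes of
the generations.
-/

noncomputable section

namespace DruryArveson

open scoped InnerProductSpace ComplexConjugate

/-! ### The scalar kernels -/

section PowerSeries

lemma summable_mul_multinomial {ι : Type*} [Fintype ι] {c : ℕ → ℝ} (hc : ∀ n, 0 ≤ c n)
    {x : ι → ℝ} (hx : ∀ i, 0 ≤ x i) (h : Summable fun n => c n * (∑ i, x i) ^ n) :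
    Summable fun α : ι → ℕ =>
      c (∑ i, α i) * (Nat.multinomial Finset.univ α * ∏ i, x i ^ α i) := by
  classical
  have hxα : ∀ α : ι → ℕ, 0 ≤ ∏ i, x i ^ α i := fun α =>
    Finset.prod_nonneg fun i _ => pow_nonneg (hx i) _
  refine summable_of_sum_le (c := ∑' n, c n * (∑ i, x i) ^ n)
    (fun α => mul_nonneg (hc _) (mul_nonneg (Nat.cast_nonneg _) (hxα α))) fun s => ?_
  calc ∑ α ∈ s, c (∑ i, α i) * (Nat.multinomial Finset.univ α * ∏ i, x i ^ α i)
      = ∑ n ∈ s.image fun α => ∑ i, α i, ∑ α ∈ s with ∑ i, α i = n,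
          c (∑ i, α i) * (Nat.multinomial Finset.univ α * ∏ i, x i ^ α i) :=
        (Finset.sum_fiberwise_of_maps_to (fun α => Finset.mem_image_of_mem _) _).symm
    _ ≤ ∑ n ∈ s.image fun α => ∑ i, α i, c n * (∑ i, x i) ^ n := by
        refine Finset.sum_le_sum fun n _ => ?_
        rw [Finset.sum_pow_eq_sum_piAntidiag, Finset.mul_sum]
        refine (Finset.sum_congr rfl fun α hα => by rw [(Finset.mem_filter.1 hα).2]).trans_le
          (Finset.sum_le_sum_of_subset_of_nonneg (fun α hα => ?_) fun α _ _ =>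
            mul_nonneg (hc n) (mul_nonneg (Nat.cast_nonneg _) (hxα α)))
        simp [Finset.mem_piAntidiag, (Finset.mem_filter.1 hα).2]
    _ ≤ ∑' n, c n * (∑ i, x i) ^ n :=
        h.sum_le_tsum _ fun n _ =>
          mul_nonneg (hc n) (pow_nonneg (Finset.sum_nonneg fun i _ => hx i) n)

variable {d : ℕ}

/-- On the line through `ζ`, the power series becomes a power series in one variable whose
coefficients are its homogeneous parts at `ζ`. -/
lemma homogeneousPart_eq_zero_of_vanish {b : (Fin d → ℕ) → ℂ}
    (h : ∀ z : UnitBall d, HasSum (fun α => b α * monomial z α) 0) (n : ℕ) (ζ : Fin d → ℂ) :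
    ∑ α ∈ Finset.piAntidiag Finset.univ n, b α * ∏ i, ζ i ^ α i = 0 := by
  classical
  set c : ℕ → ℂ := fun n => ∑ α ∈ Finset.piAntidiag Finset.univ n, b α * ∏ i, ζ i ^ α i with hc
  have hball : ∀ᶠ t : ℂ in nhds 0,
      t • WithLp.toLp 2 ζ ∈ Metric.ball (0 : EuclideanSpace ℂ (Fin d)) 1 := by
    have hcont : Continuous fun t : ℂ => t • WithLp.toLp 2 ζ := by fun_prop
    exact hcont.continuousAt.eventually_mem (by simpa using Metric.ball_mem_nhds _ one_pos)
  have hseries : HasFPowerSeriesAt (0 : ℂ → ℂ) (FormalMultilinearSeries.ofScalars ℂ c) 0 := by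
    rw [hasFPowerSeriesAt_iff]
    filter_upwards [hball] with t ht
    convert! (h ⟨_, ht⟩).tsum_fiberwise (fun α => ∑ i, α i) using 2 with m
    have hfiber : (fun α : Fin d → ℕ => ∑ i, α i) ⁻¹' {m} =
        ((Finset.piAntidiag Finset.univ m : Finset (Fin d → ℕ)) : Set (Fin d → ℕ)) := by
      ext α; simp [Finset.mem_piAntidiag]
    rw [FormalMultilinearSeries.coeff_ofScalars, hfiber,
      Finset.tsum_subtype' _ (fun α => b α * monomial ⟨_, ht⟩ α), hc, smul_eq_mul, Finset.mul_sum]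
    refine Finset.sum_congr rfl fun α hα => ?_
    have hm : ∑ i, α i = m := by simpa [Finset.mem_piAntidiag] using hα
    simp only [monomial, PiLp.smul_apply, smul_eq_mul, mul_pow, Finset.prod_mul_distrib,
      Finset.prod_pow_eq_pow_sum, hm]
    ring
  have hcoeff : (FormalMultilinearSeries.ofScalars ℂ c).coeff n = 0 := by
    rw [hseries.eq_zero]; rfl
  rwa [FormalMultilinearSeries.coeff_ofScalars] at hcoeff

lemma coeff_eq_zero_of_vanish {b : (Fin d → ℕ) → ℂ}
    (h : ∀ z : UnitBall d, HasSum (fun α => b α * monomial z α) 0) : b = 0 := by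
  classical
  funext α
  set n := ∑ i, α i with hn
  let p : MvPolynomial (Fin d) ℂ := ∑ β ∈ Finset.piAntidiag Finset.univ n,
    MvPolynomial.monomial (Finsupp.equivFunOnFinite.symm β) (b β)
  have hp : p = 0 := MvPolynomial.funext fun ζ => by
    rw [map_zero, ← homogeneousPart_eq_zero_of_vanish h n ζ]
    simp [p, MvPolynomial.eval_monomial, Finsupp.prod_fintype]
  have hcoeff := congrArg (MvPolynomial.coeff (Finsupp.equivFunOnFinite.symm α)) hp
  simpa [p, MvPolynomial.coeff_sum, MvPolynomial.coeff_monomial, Finset.mem_piAntidiag, ← hn]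
    using hcoeff

end PowerSeries

section Multiindices

variable {d : ℕ}

lemma monomial_add_single (z : UnitBall d) (α : Fin d → ℕ) (k : Fin d) :
    monomial z (α + Pi.single k 1) = monomial z α * (z : EuclideanSpace ℂ (Fin d)) k := by
  simp only [monomial, Pi.add_apply, pow_add, Finset.prod_mul_distrib, Pi.single_apply, pow_ite,
    pow_one, pow_zero, Finset.prod_ite_eq', Finset.mem_univ, if_true]

lemma norm_monomial_sq (z : UnitBall d) (α : Fin d → ℕ) :
    ‖monomial z α‖ ^ 2 = ∏ i, (‖(z : EuclideanSpace ℂ (Fin d)) i‖ ^ 2) ^ α i := by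
  simp only [monomial, norm_prod, norm_pow, ← Finset.prod_pow]
  exact Finset.prod_congr rfl fun i _ => pow_right_comm _ _ _

lemma sum_norm_sq_coord_lt_one (z : UnitBall d) :
    ∑ i, ‖(z : EuclideanSpace ℂ (Fin d)) i‖ ^ 2 < 1 := by
  rw [← EuclideanSpace.norm_sq_eq]
  exact pow_lt_one₀ (norm_nonneg _) (mem_ball_zero_iff.1 z.2) two_ne_zero

lemma mfactorial_pos (α : Fin d → ℕ) : 0 < mfactorial α :=
  Finset.prod_pos fun _ _ => Nat.factorial_pos _

lemma mfactorial_mul_mfactorial_le (α β : Fin d → ℕ) :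
    mfactorial α * mfactorial β ≤ mfactorial (α + β) := by
  unfold mfactorial
  rw [← Finset.prod_mul_distrib]
  exact Finset.prod_le_prod' fun i _ => Nat.le_of_dvd (Nat.factorial_pos _)
    (Nat.factorial_mul_factorial_dvd_factorial_add _ _)

lemma mfactorial_add_single (α : Fin d → ℕ) (k : Fin d) :
    mfactorial (α + Pi.single k 1) = mfactorial α * (α k + 1) := by
  have hfactor : ∀ i, ((α + Pi.single k 1 : Fin d → ℕ) i).factorial =
      (α i).factorial * if i = k then α i + 1 else 1 := fun i => by
    by_cases hi : i = k
    · subst hi; simp [Nat.factorial_succ, mul_comm]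
    · simp [hi]
  simp only [mfactorial, hfactor, Finset.prod_mul_distrib, Finset.prod_ite_eq', Finset.mem_univ,
    if_true]

lemma exists_eq_add_single {α : Fin d → ℕ} {k : Fin d} (hk : α k ≠ 0) :
    ∃ β : Fin d → ℕ, α = β + Pi.single k 1 := by
  refine ⟨α - Pi.single k 1, (tsub_add_cancel_of_le fun i => ?_).symm⟩
  rcases eq_or_ne i k with rfl | hi
  · simpa [Nat.one_le_iff_ne_zero] using hk
  · simp [hi]

end Multiindices

section KernelCoeff

variable {d a : ℕ}

/-- The coefficient of `z^α conj(w)^α` in the scalar kernel `scalarKernel a δ z w`. -/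
def kernelCoeff (a : ℕ) (δ α : Fin d → ℕ) : ℝ :=
  (mfactorial δ : ℝ) / (mfactorial (δ + α) : ℝ) *
    ∏ j ∈ Finset.range (∑ i, α i), (((∑ i, δ i : ℕ) : ℝ) + a + j)

lemma kernelCoeff_pos (ha : 0 < a) (δ α : Fin d → ℕ) : 0 < kernelCoeff a δ α := by
  have := mfactorial_pos δ
  have := mfactorial_pos (δ + α)
  exact mul_pos (by positivity) (Finset.prod_pos fun j _ => by positivity)

lemma prod_range_add_succ (A n : ℕ) :
    ∏ j ∈ Finset.range n, (A + 1 + j) = n.factorial * (n + A).choose A := by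
  rw [← Nat.ascFactorial_eq_prod_range, Nat.ascFactorial_eq_factorial_mul_choose, add_comm A n,
    Nat.choose_symm_add]

lemma kernelCoeff_le {A : ℕ} {δ : Fin d → ℕ} (hA : ∑ i, δ i + a = A + 1) (α : Fin d → ℕ) :
    kernelCoeff a δ α ≤ (∑ i, α i + A).choose A * Nat.multinomial Finset.univ α := by
  have hα : (0 : ℝ) < mfactorial α := by exact_mod_cast mfactorial_pos α
  have hδα : (0 : ℝ) < mfactorial (δ + α) := by exact_mod_cast mfactorial_pos (δ + α)
  have hmul : (mfactorial δ : ℝ) * mfactorial α ≤ mfactorial (δ + α) := by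
    exact_mod_cast mfactorial_mul_mfactorial_le δ α
  have hmultinomial : (mfactorial α : ℝ) * Nat.multinomial Finset.univ α =
      (∑ i, α i).factorial := by
    exact_mod_cast Nat.multinomial_spec Finset.univ α
  have hprod : ∏ j ∈ Finset.range (∑ i, α i), (((∑ i, δ i : ℕ) : ℝ) + a + j) =
      (∑ i, α i).factorial * (∑ i, α i + A).choose A := by
    have := prod_range_add_succ A (∑ i, α i)
    rw [← hA] at this
    exact_mod_cast this
  calc kernelCoeff a δ α
      ≤ 1 / mfactorial α * ∏ j ∈ Finset.range (∑ i, α i), (((∑ i, δ i : ℕ) : ℝ) + a + j) := by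
        refine mul_le_mul_of_nonneg_right ?_ (Finset.prod_nonneg fun j _ => by positivity)
        rwa [div_le_div_iff₀ hδα hα, one_mul]
    _ = (∑ i, α i + A).choose A * Nat.multinomial Finset.univ α := by
        rw [hprod, ← hmultinomial]
        field_simp

lemma summable_kernelCoeff (ha : 0 < a) (δ : Fin d → ℕ) {x : Fin d → ℝ} (hx : ∀ i, 0 ≤ x i)
    (hx1 : ∑ i, x i < 1) : Summable fun α : Fin d → ℕ => kernelCoeff a δ α * ∏ i, x i ^ α i := by
  obtain ⟨A, hA⟩ := Nat.exists_eq_add_one_of_ne_zero (n := ∑ i, δ i + a) (by omega)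
  have hgeom : Summable fun n : ℕ => ((n + A).choose A : ℝ) * (∑ i, x i) ^ n :=
    summable_choose_mul_geometric_of_norm_lt_one A
      (by rwa [Real.norm_of_nonneg (Finset.sum_nonneg fun i _ => hx i)])
  have hxα : ∀ α : Fin d → ℕ, 0 ≤ ∏ i, x i ^ α i := fun α =>
    Finset.prod_nonneg fun i _ => pow_nonneg (hx i) _
  refine (summable_mul_multinomial (fun n => Nat.cast_nonneg _) hx hgeom).of_nonneg_of_le
    (fun α => mul_nonneg (kernelCoeff_pos ha δ α).le (hxα α)) fun α => ?_
  rw [← mul_assoc]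
  exact mul_le_mul_of_nonneg_right (kernelCoeff_le hA α) (hxα α)

/-- The quotient is `(|δ| + a + |α|) / (δ k + α k + 1)`. -/
lemma kernelCoeff_le_add_single (ha : 0 < a) (δ α : Fin d → ℕ) (k : Fin d) :
    kernelCoeff a δ α ≤ kernelCoeff a δ (α + Pi.single k 1) := by
  set P := ∏ j ∈ Finset.range (∑ i, α i), (((∑ i, δ i : ℕ) : ℝ) + a + j)
  have : 0 ≤ P := Finset.prod_nonneg fun j _ => by positivity
  have hfac := mfactorial_pos (δ + α)
  have hdegree : ∑ i, (α + Pi.single k 1 : Fin d → ℕ) i = ∑ i, α i + 1 := by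
    simp [Finset.sum_add_distrib]
  have hle : (((δ + α) k + 1 : ℕ) : ℝ) ≤ ((∑ i, δ i : ℕ) : ℝ) + a + (∑ i, α i : ℕ) := by
    have hk := Finset.single_le_sum (f := δ + α) (fun _ _ => Nat.zero_le _) (Finset.mem_univ k)
    rw [Finset.sum_congr rfl fun i _ => Pi.add_apply δ α i, Finset.sum_add_distrib] at hk
    norm_cast
    omega
  calc kernelCoeff a δ α = mfactorial δ / mfactorial (δ + α) * P := rfl
    _ = mfactorial δ / (mfactorial (δ + α) * ((δ + α) k + 1 : ℕ)) *
          (P * ((δ + α) k + 1 : ℕ)) := by field_simp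
    _ ≤ mfactorial δ / (mfactorial (δ + α) * ((δ + α) k + 1 : ℕ)) *
          (P * (((∑ i, δ i : ℕ) : ℝ) + a + (∑ i, α i : ℕ))) := by gcongr
    _ = kernelCoeff a δ (α + Pi.single k 1) := by
      rw [kernelCoeff, hdegree, Finset.prod_range_succ, ← add_assoc, mfactorial_add_single,
        Nat.cast_mul]

end KernelCoeff

/-! ### Diagonal models -/

section ScalarModel

variable {d a : ℕ}

/-- The Hilbert space of the coefficients of a power series with respect to the orthonormal basis of
normalized monomials of a space of functions on the unit ball of `ℂ^d`. -/
abbrev CoeffSpace (d : ℕ) : Type := lp (fun _ : Fin d → ℕ => ℂ) 2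

lemma kernelCoeff_sqrt_ne_zero (ha : 0 < a) (δ α : Fin d → ℕ) :
    (√(kernelCoeff a δ α) : ℂ) ≠ 0 := by
  exact_mod_cast (Real.sqrt_pos.2 (kernelCoeff_pos ha δ α)).ne'

/-- The coefficients of the reproducing kernel function at `z` of the space with the kernel
`scalarKernel a δ`. -/
def kernelVec (ha : 0 < a) (δ : Fin d → ℕ) (z : UnitBall d) : CoeffSpace d :=
  ⟨fun α => √(kernelCoeff a δ α) * conj (monomial z α), memℓp_gen <| by
    refine (summable_kernelCoeff ha δ (fun j => sq_nonneg _) (sum_norm_sq_coord_lt_one z)).congr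
      fun α => ?_
    rw [← norm_monomial_sq]
    simp [mul_pow, Real.sq_sqrt (kernelCoeff_pos ha δ α).le]⟩

lemma kernelVec_apply (ha : 0 < a) (δ : Fin d → ℕ) (z : UnitBall d) (α : Fin d → ℕ) :
    kernelVec ha δ z α = √(kernelCoeff a δ α) * conj (monomial z α) := rfl

lemma hasSum_inner_kernelVec (ha : 0 < a) (δ : Fin d → ℕ) (z : UnitBall d) (f : CoeffSpace d) :
    HasSum (fun α => √(kernelCoeff a δ α) * f α * monomial z α) ⟪kernelVec ha δ z, f⟫_ℂ := by
  convert! lp.hasSum_inner (𝕜 := ℂ) (kernelVec ha δ z) f using 2 with α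
  simp only [kernelVec_apply, RCLike.inner_apply, map_mul, Complex.conj_ofReal, Complex.conj_conj]
  ring

lemma inner_kernelVec_kernelVec (ha : 0 < a) (δ : Fin d → ℕ) (z w : UnitBall d) :
    ⟪kernelVec ha δ z, kernelVec ha δ w⟫_ℂ = scalarKernel a δ z w := by
  rw [← (hasSum_inner_kernelVec ha δ z _).tsum_eq, scalarKernel]
  refine tsum_congr fun α => ?_
  rw [kernelVec_apply, ← mul_assoc, ← Complex.ofReal_mul,
    Real.mul_self_sqrt (kernelCoeff_pos ha δ α).le, kernelCoeff]
  push_cast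
  ring

lemma eq_zero_of_inner_kernelVec_eq_zero (ha : 0 < a) {δ : Fin d → ℕ} {f : CoeffSpace d}
    (hf : ∀ z, ⟪kernelVec ha δ z, f⟫_ℂ = 0) : f = 0 := by
  have hvanish := coeff_eq_zero_of_vanish fun z => hf z ▸ hasSum_inner_kernelVec ha δ z f
  ext α
  exact (mul_eq_zero.1 (congrFun hvanish α)).resolve_left (kernelCoeff_sqrt_ne_zero ha δ α)

/-- The weights of the multiplication by `z_k` with respect to the normalized monomials. -/
def mulWeight (a : ℕ) (δ : Fin d → ℕ) (k : Fin d) (α : Fin d → ℕ) : ℝ :=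
  √(kernelCoeff a δ α) / √(kernelCoeff a δ (α + Pi.single k 1))

lemma mulWeight_pos (ha : 0 < a) (δ : Fin d → ℕ) (k : Fin d) (α : Fin d → ℕ) :
    0 < mulWeight a δ k α :=
  div_pos (Real.sqrt_pos.2 (kernelCoeff_pos ha _ _)) (Real.sqrt_pos.2 (kernelCoeff_pos ha _ _))

lemma mulWeight_le_one (ha : 0 < a) (δ : Fin d → ℕ) (k : Fin d) (α : Fin d → ℕ) :
    mulWeight a δ k α ≤ 1 :=
  div_le_one_of_le₀ (Real.sqrt_le_sqrt (kernelCoeff_le_add_single ha δ α k)) (Real.sqrt_nonneg _)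

lemma sum_norm_mulWeight_mul_sq_le (ha : 0 < a) (δ : Fin d → ℕ) (k : Fin d) (f : CoeffSpace d)
    (s : Finset (Fin d → ℕ)) :
    ∑ α ∈ s, ‖mulWeight a δ k α * f (α + Pi.single k 1)‖ ^ 2 ≤ ‖f‖ ^ 2 := by
  calc ∑ α ∈ s, ‖mulWeight a δ k α * f (α + Pi.single k 1)‖ ^ 2
      ≤ ∑ α ∈ s, ‖f (α + Pi.single k 1)‖ ^ 2 := by
        refine Finset.sum_le_sum fun α _ => pow_le_pow_left₀ (norm_nonneg _) ?_ 2
        rw [norm_mul, Complex.norm_real, Real.norm_of_nonneg (mulWeight_pos ha δ k α).le]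
        exact mul_le_of_le_one_left (norm_nonneg _) (mulWeight_le_one ha δ k α)
    _ = ∑ β ∈ s.map (addRightEmbedding (Pi.single k 1)), ‖f β‖ ^ 2 := by
        rw [Finset.sum_map]; rfl
    _ ≤ ‖f‖ ^ 2 := by
        simpa only [ENNReal.toReal_ofNat, Real.rpow_ofNat] using
          lp.sum_rpow_le_norm_rpow (p := 2) (by norm_num) f _

/-- The adjoint of the multiplication by `z_k` on the space with the kernel `scalarKernel a δ`, in
terms of the coefficients. -/
def backwardShift (ha : 0 < a) (δ : Fin d → ℕ) (k : Fin d) : CoeffSpace d →L[ℂ] CoeffSpace d :=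
  LinearMap.mkContinuous
    { toFun := fun f => ⟨fun α => mulWeight a δ k α * f (α + Pi.single k 1),
        memℓp_gen' (C := ‖f‖ ^ 2) fun s => by
          simpa using sum_norm_mulWeight_mul_sq_le ha δ k f s⟩
      map_add' := fun f g => by ext α; exact mul_add _ _ _
      map_smul' := fun c f => by ext α; exact mul_left_comm _ _ _ }
    1 fun f => by
      refine lp.norm_le_of_forall_sum_le (by norm_num) (by positivity) fun s => ?_
      simpa using sum_norm_mulWeight_mul_sq_le ha δ k f s

lemma backwardShift_apply (ha : 0 < a) (δ : Fin d → ℕ) (k : Fin d) (f : CoeffSpace d)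
    (α : Fin d → ℕ) :
    backwardShift ha δ k f α = mulWeight a δ k α * f (α + Pi.single k 1) := rfl

lemma backwardShift_kernelVec (ha : 0 < a) (δ : Fin d → ℕ) (k : Fin d) (z : UnitBall d) :
    backwardShift ha δ k (kernelVec ha δ z) =
      conj ((z : EuclideanSpace ℂ (Fin d)) k) • kernelVec ha δ z := by
  ext α
  have hne := kernelCoeff_sqrt_ne_zero ha δ (α + Pi.single k 1)
  rw [backwardShift_apply, kernelVec_apply, lp.coeFn_smul, Pi.smul_apply, kernelVec_apply,
    monomial_add_single, map_mul, mulWeight, smul_eq_mul]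
  push_cast
  field_simp

lemma forall_backwardShift_eq_zero_iff (ha : 0 < a) (δ : Fin d → ℕ) (f : CoeffSpace d) :
    (∀ k, backwardShift ha δ k f = 0) ↔ ∀ α ≠ 0, f α = 0 := by
  constructor
  · intro hf α hα
    obtain ⟨k, hk⟩ := Function.ne_iff.1 hα
    obtain ⟨β, rfl⟩ := exists_eq_add_single hk
    have hβ := congrArg (fun g : CoeffSpace d => g β) (hf k)
    have hne : (mulWeight a δ k β : ℂ) ≠ 0 := by exact_mod_cast (mulWeight_pos ha δ k β).ne'
    exact (mul_eq_zero.1 hβ).resolve_left hne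
  · intro hf k
    ext α
    have hne : α + Pi.single k 1 ≠ 0 := fun h => by simpa using congrFun h k
    rw [backwardShift_apply, hf _ hne, mul_zero]
    rfl

end ScalarModel

section Diagonal

variable {ι : Type*} {W : Type*} [NormedAddCommGroup W] [InnerProductSpace ℂ W]

/-- The diagonal operator `(f_i)_i ↦ (A_i f_i)_i` on the Hilbert sum of copies of `W`. -/
def diagonalOperator (A : ι → W →L[ℂ] W) :
    PiLp 2 (fun _ : ι => W) →L[ℂ] PiLp 2 (fun _ : ι => W) :=
  (PiLp.continuousLinearEquiv 2 ℂ fun _ : ι => W).symm.toContinuousLinearMap ∘L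
    ContinuousLinearMap.piMap A ∘L
      (PiLp.continuousLinearEquiv 2 ℂ fun _ : ι => W).toContinuousLinearMap

lemma diagonalOperator_apply (A : ι → W →L[ℂ] W) (f : PiLp 2 (fun _ : ι => W)) (i : ι) :
    diagonalOperator A f i = A i (f i) := rfl

lemma adjoint_diagonalOperator [Fintype ι] [CompleteSpace W] (A : ι → W →L[ℂ] W) :
    ContinuousLinearMap.adjoint (diagonalOperator A) =
      diagonalOperator fun i => ContinuousLinearMap.adjoint (A i) := by
  symm
  rw [ContinuousLinearMap.eq_adjoint_iff]
  intro f g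
  simp only [PiLp.inner_apply, diagonalOperator_apply, ContinuousLinearMap.adjoint_inner_left]

lemma inner_piLp_single_left [Fintype ι] [DecidableEq ι] (i : ι) (x : W)
    (f : PiLp 2 fun _ : ι => W) : ⟪PiLp.single 2 i x, f⟫_ℂ = ⟪x, f i⟫_ℂ := by
  rw [PiLp.inner_apply, Finset.sum_eq_single i]
  · simp
  · intro j _ hj
    simp [hj]
  · simp

end Diagonal

section JointCokernel

/-- The joint cokernel `⋂ k, ker M_k^*` of a tuple of operators. -/
def jointCokernel {κ H : Type*} [NormedAddCommGroup H] [InnerProductSpace ℂ H]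
    (M : κ → H →L[ℂ] H) : Submodule ℂ H := ⨅ k, (M k).rangeᗮ

lemma mem_jointCokernel {κ H : Type*} [NormedAddCommGroup H] [InnerProductSpace ℂ H]
    {M : κ → H →L[ℂ] H} {f : H} : f ∈ jointCokernel M ↔ ∀ k g, ⟪f, M k g⟫_ℂ = 0 := by
  simp [jointCokernel, Submodule.mem_iInf, Submodule.mem_orthogonal']

lemma finrank_jointCokernel_eq {κ H H' : Type*} [NormedAddCommGroup H] [InnerProductSpace ℂ H]
    [NormedAddCommGroup H'] [InnerProductSpace ℂ H'] {M : κ → H →L[ℂ] H} {M' : κ → H' →L[ℂ] H'}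
    (U : H ≃ₗᵢ[ℂ] H') (hU : ∀ k f, U (M k f) = M' k (U f)) :
    Module.finrank ℂ (jointCokernel M) = Module.finrank ℂ (jointCokernel M') := by
  have hmap : (jointCokernel M).map (U.toLinearEquiv : H →ₗ[ℂ] H') = jointCokernel M' := by
    ext f
    obtain ⟨f, rfl⟩ := U.surjective f
    rw [Submodule.mem_map_equiv, mem_jointCokernel, mem_jointCokernel]
    refine forall_congr' fun k => ?_
    rw [U.surjective.forall]
    simp [← hU]
  rw [← hmap]
  exact (LinearEquiv.finrank_map_eq U.toLinearEquiv _).symm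

lemma HilbertModule.Iso.finrank_jointCokernel_eq {d a : ℕ} {T T' : TreeProduct d}
    {X : HilbertModule a T} {Y : HilbertModule a T'} (h : X.Iso Y) :
    Module.finrank ℂ (jointCokernel X.M) = Module.finrank ℂ (jointCokernel Y.M) := by
  obtain ⟨U, hU⟩ := h
  exact DruryArveson.finrank_jointCokernel_eq U hU

end JointCokernel

section DiagonalModel

variable {ι ι' : Type} [Fintype ι] [Fintype ι'] {d a : ℕ}

/-- The multiplication by `z_k` on the direct sum of the spaces with the kernels
`scalarKernel a (δ i)`, in terms of the coefficients. -/
def mulCoord (ha : 0 < a) (δ : ι → Fin d → ℕ) (k : Fin d) :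
    PiLp 2 (fun _ : ι => CoeffSpace d) →L[ℂ] PiLp 2 (fun _ : ι => CoeffSpace d) :=
  diagonalOperator fun i => ContinuousLinearMap.adjoint (backwardShift ha (δ i) k)

lemma mem_jointCokernel_mulCoord (ha : 0 < a) (δ : ι → Fin d → ℕ)
    (f : PiLp 2 (fun _ : ι => CoeffSpace d)) :
    f ∈ jointCokernel (mulCoord ha δ) ↔ ∀ i, ∀ α ≠ 0, f i α = 0 := by
  simp only [jointCokernel, Submodule.mem_iInf, ContinuousLinearMap.orthogonal_range, mulCoord,
    adjoint_diagonalOperator, ContinuousLinearMap.adjoint_adjoint]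
  rw [forall_congr' fun i => (forall_backwardShift_eq_zero_iff ha (δ i) (f i)).symm, forall_comm]
  refine forall_congr' fun k => ?_
  rw [LinearMap.mem_ker, PiLp.ext_iff]
  rfl

lemma finrank_jointCokernel_mulCoord (ha : 0 < a) (δ : ι → Fin d → ℕ) :
    Module.finrank ℂ (jointCokernel (mulCoord ha δ)) = Fintype.card ι := by
  classical
  let constantTerm : jointCokernel (mulCoord ha δ) →ₗ[ℂ] ι → ℂ :=
    { toFun := fun f i => (f : PiLp 2 (fun _ : ι => CoeffSpace d)) i 0
      map_add' := fun f g => rfl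
      map_smul' := fun c f => rfl }
  have hbij : Function.Bijective constantTerm := by
    refine ⟨(injective_iff_map_eq_zero _).2 fun f hf => ?_, fun c => ?_⟩
    · ext i α
      rcases eq_or_ne α 0 with rfl | hα
      · exact congrFun hf i
      · exact (mem_jointCokernel_mulCoord ha δ _).1 f.2 i α hα
    · refine ⟨⟨WithLp.toLp 2 fun i => lp.single 2 0 (c i), ?_⟩, funext fun i => ?_⟩
      · exact (mem_jointCokernel_mulCoord ha δ _).2 fun i α hα => lp.single_apply_ne _ _ _ hα
      · exact lp.single_apply_self (E := fun _ : Fin d → ℕ => ℂ) 2 0 (c i)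
  rw [(LinearEquiv.ofBijective constantTerm hbij).finrank_eq, Module.finrank_fintype_fun_eq_card]

variable {V : Type} [NormedAddCommGroup V] [InnerProductSpace ℂ V]

/-- The value at `z` of the `V`-valued function with the given coefficients, when the `i`-th
component refers to the vector `b i`. -/
def evalModel (ha : 0 < a) (δ : ι → Fin d → ℕ) (b : OrthonormalBasis ι ℂ V) (z : UnitBall d) :
    PiLp 2 (fun _ : ι => CoeffSpace d) →L[ℂ] V :=
  ∑ i, (innerSL ℂ (kernelVec ha (δ i) z) ∘L PiLp.proj 2 (fun _ : ι => CoeffSpace d) i).smulRight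
    (b i)

lemma evalModel_apply (ha : 0 < a) (δ : ι → Fin d → ℕ) (b : OrthonormalBasis ι ℂ V)
    (z : UnitBall d) (f : PiLp 2 (fun _ : ι => CoeffSpace d)) :
    evalModel ha δ b z f = ∑ i, ⟪kernelVec ha (δ i) z, f i⟫_ℂ • b i := by
  simp [evalModel]

lemma evalModel_mulCoord (ha : 0 < a) (δ : ι → Fin d → ℕ) (b : OrthonormalBasis ι ℂ V)
    (z : UnitBall d) (k : Fin d) (f : PiLp 2 (fun _ : ι => CoeffSpace d)) :
    evalModel ha δ b z (mulCoord ha δ k f) =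
      (z : EuclideanSpace ℂ (Fin d)) k • evalModel ha δ b z f := by
  simp only [evalModel_apply, mulCoord, diagonalOperator_apply,
    ContinuousLinearMap.adjoint_inner_right, backwardShift_kernelVec, inner_smul_left,
    Complex.conj_conj, Finset.smul_sum, smul_smul]

/-- The direct sum of the spaces with the kernels `scalarKernel a (δ i)`, as a reproducing kernel
Hilbert space of `V`-valued functions. -/
@[reducible]
def modelRKHS (ha : 0 < a) (δ : ι → Fin d → ℕ) (b : OrthonormalBasis ι ℂ V) :
    RKHS ℂ (PiLp 2 (fun _ : ι => CoeffSpace d)) (UnitBall d) V where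
  coeCLM := ContinuousLinearMap.pi (evalModel ha δ b)
  coeCLM_injective := by
    refine (injective_iff_map_eq_zero _).2 fun f hf => ?_
    have hf' : ∀ z, ∑ i, ⟪kernelVec ha (δ i) z, f i⟫_ℂ • b i = 0 := fun z =>
      (evalModel_apply ha δ b z f).symm.trans (congrFun hf z)
    refine PiLp.ext fun i => eq_zero_of_inner_kernelVec_eq_zero ha (δ := δ i) fun z => ?_
    exact Fintype.linearIndependent_iff.1 b.orthonormal.linearIndependent _ (hf' z) i

lemma modelRKHS_kernel_apply [CompleteSpace V] (ha : 0 < a) (δ : ι → Fin d → ℕ)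
    (b : OrthonormalBasis ι ℂ V) (z w : UnitBall d) (i : ι) :
    letI := modelRKHS ha δ b
    RKHS.kernel (PiLp 2 (fun _ : ι => CoeffSpace d)) z w (b i) =
      scalarKernel a (δ i) z w • b i := by
  classical
  let _ := modelRKHS ha δ b
  have hker : RKHS.kerFun (PiLp 2 (fun _ : ι => CoeffSpace d)) w (b i) =
      PiLp.single 2 i (kernelVec ha (δ i) w) := by
    refine ext_inner_right ℂ fun f => ?_
    rw [RKHS.kerFun_inner]
    change ⟪b i, evalModel ha δ b w f⟫_ℂ = _
    rw [inner_piLp_single_left]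
    simp [evalModel_apply, b.inner_eq_ite]
  rw [← RKHS.kerFun_apply, hker]
  change evalModel ha δ b z _ = _
  rw [evalModel_apply, Finset.sum_eq_single i, PiLp.single_apply]
  · simp [inner_kernelVec_kernelVec]
  · intro j _ hj
    simp [hj]
  · simp

variable {T T' : TreeProduct d}

/-- The Hilbert module of `T` in terms of an orthonormal basis of `T.E a` that diagonalizes the
kernel. -/
def diagonalModule (ha : 0 < a) (b : OrthonormalBasis ι ℂ (T.E a)) (δ : ι → Fin d → ℕ)
    (hb : ∀ z w i, T.kernel a z w (b i) = scalarKernel a (δ i) z w • b i) : HilbertModule a T where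
  H := PiLp 2 (fun _ : ι => CoeffSpace d)
  rkhs := modelRKHS ha δ b
  kernel_eq := by
    ext z w : 1
    apply ContinuousLinearMap.coe_injective
    refine b.toBasis.ext fun i => ?_
    rw [b.coe_toBasis]
    exact (modelRKHS_kernel_apply ha δ b z w i).trans (hb z w i).symm
  M := mulCoord ha δ
  M_apply k f z := evalModel_mulCoord ha δ b z k f

lemma diagonalModule_iso (ha : 0 < a) {b : OrthonormalBasis ι ℂ (T.E a)} {δ : ι → Fin d → ℕ}
    (hb : ∀ z w i, T.kernel a z w (b i) = scalarKernel a (δ i) z w • b i)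
    {b' : OrthonormalBasis ι' ℂ (T'.E a)} {δ' : ι' → Fin d → ℕ}
    (hb' : ∀ z w i, T'.kernel a z w (b' i) = scalarKernel a (δ' i) z w • b' i)
    (e : ι ≃ ι') (he : ∀ i, δ' (e i) = δ i) :
    (diagonalModule ha b δ hb).Iso (diagonalModule ha b' δ' hb') := by
  refine ⟨LinearIsometryEquiv.piLpCongrLeft 2 ℂ (CoeffSpace d) e, fun k f => PiLp.ext fun i => ?_⟩
  let f' : PiLp 2 (fun _ : ι => CoeffSpace d) := f
  change ContinuousLinearMap.adjoint (backwardShift ha (δ (e.symm i)) k) (f' (e.symm i)) =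
    ContinuousLinearMap.adjoint (backwardShift ha (δ' i) k) (f' (e.symm i))
  rw [← he, e.apply_symm_apply]

end DiagonalModel

/-! ### The joint cokernel -/

namespace RootedDirectedTree

variable {T : RootedDirectedTree}

lemma Adj.ne_root {u v : T.V} (h : T.Adj u v) : v ≠ T.root :=
  fun e => T.not_adj_root u (e ▸ h)

lemma Adj.parent_eq {u v : T.V} (h : T.Adj u v) : T.parent v = u :=
  (T.existsUnique_parent v h.ne_root).unique (TreeProduct.adj_parent T v h.ne_root) h

lemma exists_mem_generation (v : T.V) : ∃ n, v ∈ T.generation n := by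
  induction T.reachable v with
  | refl => exact ⟨0, rfl⟩
  | tail _ h ih =>
    obtain ⟨n, hn⟩ := ih
    exact ⟨n + 1, _, hn, h⟩

lemma eq_of_mem_generation {n m : ℕ} {v : T.V} (hn : v ∈ T.generation n)
    (hm : v ∈ T.generation m) : n = m := by
  induction n generalizing m v with
  | zero =>
    cases m with
    | zero => rfl
    | succ m =>
      obtain ⟨u, -, h⟩ := hm
      exact absurd hn h.ne_root
  | succ n ih =>
    obtain ⟨u, hu, h⟩ := hn
    cases m with
    | zero => exact absurd hm h.ne_root
    | succ m =>
      obtain ⟨u', hu', h'⟩ := hm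
      obtain rfl : u = u' := h.parent_eq.symm.trans h'.parent_eq
      rw [ih hu hu']

lemma mem_generation_iff {n : ℕ} {v : T.V} : v ∈ T.generation n ↔ T.depth v = n := by
  have hdepth : v ∈ T.generation (T.depth v) :=
    Nat.sInf_mem (s := {n | v ∈ T.generation n}) (exists_mem_generation v)
  exact ⟨fun hn => eq_of_mem_generation hdepth hn, fun h => h ▸ hdepth⟩

lemma depth_root : T.depth T.root = 0 := mem_generation_iff.1 rfl

lemma Adj.depth_eq {u v : T.V} (h : T.Adj u v) : T.depth v = T.depth u + 1 :=
  mem_generation_iff.1 ⟨u, mem_generation_iff.2 rfl, h⟩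

lemma depth_parent_add_one {v : T.V} (hv : v ≠ T.root) : T.depth (T.parent v) + 1 = T.depth v :=
  (Adj.depth_eq (TreeProduct.adj_parent T v hv)).symm

lemma finite_generation (hT : ∀ v, (T.children v).Finite) (n : ℕ) : (T.generation n).Finite := by
  induction n with
  | zero => exact Set.finite_singleton _
  | succ n ih =>
    refine (ih.biUnion fun v _ => hT v).subset ?_
    rintro w ⟨v, hv, h⟩
    exact Set.mem_biUnion hv h

lemma finite_setOf_depth_le (hT : ∀ v, (T.children v).Finite) (N : ℕ) :
    {v | T.depth v ≤ N}.Finite := by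
  refine ((Set.finite_Iic N).biUnion fun n _ => finite_generation hT n).subset fun v hv => ?_
  exact Set.mem_biUnion (show T.depth v ∈ Set.Iic N from hv) (mem_generation_iff.2 rfl)

lemma depth_le_branchingIndex {u v w : T.V} (hv : T.Adj u v) (hw : T.Adj u w) (h : v ≠ w) :
    (T.depth v : ℕ∞) ≤ T.branchingIndex := by
  rw [hv.depth_eq]
  exact_mod_cast le_iSup₂_of_le (f := fun u (_ : u ∈ T.branching) => (T.depth u : ℕ∞) + 1) u
    ⟨v, hv, w, hw, h⟩ le_rfl

end RootedDirectedTree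

open RootedDirectedTree

namespace TreeProduct

variable {d : ℕ} (T : TreeProduct d) {a : ℕ}

section ChildSum

variable {T}

lemma mem_childFinset {j : Fin d} {x y : (T.tree j).V} :
    y ∈ T.childFinset j x ↔ (T.tree j).Adj x y := by
  simp [childFinset, children]

lemma par_update {j : Fin d} {v : T.Vert} {y : (T.tree j).V} (h : (T.tree j).Adj (v j) y) :
    T.par j (Function.update v j y) = v := by
  simp [par, h.parent_eq]

lemma update_par (j : Fin d) (w : T.Vert) : Function.update (T.par j w) j (w j) = w := by
  simp [par]

lemma depth_update {j : Fin d} {v : T.Vert} {y : (T.tree j).V} (h : (T.tree j).Adj (v j) y) :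
    T.depth (Function.update v j y) = T.depth v + Pi.single j 1 := by
  funext i
  rcases eq_or_ne i j with rfl | hi
  · simp [depth, h.depth_eq]
  · simp [depth, hi]

variable (T)

/-- The operator that sums a function over the sets `Chi_j(v)`. -/
def childSum (j : Fin d) : (T.Vert → ℂ) →ₗ[ℂ] T.Vert → ℂ where
  toFun f v := ∑ y ∈ T.childFinset j (v j), f (Function.update v j y)
  map_add' _ _ := funext fun _ => Finset.sum_add_distrib
  map_smul' _ _ := funext fun _ => (Finset.mul_sum _ _ _).symm

lemma childSum_apply (j : Fin d) (f : T.Vert → ℂ) (v : T.Vert) :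
    T.childSum j f v = ∑ y ∈ T.childFinset j (v j), f (Function.update v j y) := rfl

/-- The common value of the weights on `Chi_j(v)`. -/
def childWeight (a : ℕ) (j : Fin d) (v : T.Vert) : ℝ :=
  √(cSeq d a (∑ i, T.depth v i) / (T.childFinset j (v j)).card) *
    √(((T.depth v j : ℝ) + 1) / ((∑ i, T.depth v i : ℕ) + d))

variable {T}

lemma weight_update {j : Fin d} {v : T.Vert} {y : (T.tree j).V} (h : (T.tree j).Adj (v j) y) :
    T.weight a j (Function.update v j y) = T.childWeight a j v := by
  rw [weight, par_update h, childWeight]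

lemma card_childFinset_pos (j : Fin d) (x : (T.tree j).V) : 0 < (T.childFinset j x).card :=
  let ⟨y, hy⟩ := T.leafless j x
  Finset.card_pos.2 ⟨y, mem_childFinset.2 hy⟩

lemma childWeight_pos (ha : 0 < a) (j : Fin d) (v : T.Vert) : 0 < T.childWeight a j v := by
  have := Fin.pos j
  have := card_childFinset_pos j (v j)
  unfold childWeight cSeq
  positivity

lemma adjoint_shift_apply (j : Fin d) (f : T.L2) (v : T.Vert) :
    ContinuousLinearMap.adjoint (T.shift a j) f v = T.childWeight a j v * T.childSum j f v := by
  classical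
  have hmem : ∀ w, w ∉ (T.childFinset j (v j)).image (Function.update v j) →
      ⟪T.shift a j (lp.single 2 v 1) w, f w⟫_ℂ = 0 := fun w hw => by
    change ⟪T.shiftFun a j _ w, f w⟫_ℂ = 0
    rw [shiftFun]
    split_ifs with hroot
    · rw [lp.single_apply_ne, mul_zero, inner_zero_left]
      rintro rfl
      refine hw (Finset.mem_image.2 ⟨w j, mem_childFinset.2 ?_, update_par j w⟩)
      simpa [par] using adj_parent _ _ hroot
    · rw [inner_zero_left]
  calc ContinuousLinearMap.adjoint (T.shift a j) f v
      = ⟪lp.single 2 v 1, ContinuousLinearMap.adjoint (T.shift a j) f⟫_ℂ := by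
        rw [lp.inner_single_left]; simp
    _ = ∑' w, ⟪T.shift a j (lp.single 2 v 1) w, f w⟫_ℂ := by
        rw [ContinuousLinearMap.adjoint_inner_right, lp.inner_eq_tsum]
    _ = T.childWeight a j v * T.childSum j f v := by
        rw [tsum_eq_sum hmem, Finset.sum_image (Function.update_injective v j).injOn,
          childSum_apply, Finset.mul_sum]
        refine Finset.sum_congr rfl fun y hy => ?_
        have hy := mem_childFinset.1 hy
        change ⟪T.shiftFun a j _ _, _⟫_ℂ = _
        rw [shiftFun, Function.update_self, if_pos hy.ne_root, par_update hy, weight_update hy,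
          lp.single_apply_self, mul_one, RCLike.inner_apply, Complex.conj_ofReal, mul_comm]

lemma mem_E_iff (ha : 0 < a) {f : T.L2} : f ∈ T.E a ↔ ∀ j, T.childSum j f = 0 := by
  rw [E, Submodule.mem_iInf]
  refine forall_congr' fun j => ?_
  rw [LinearMap.mem_ker, lp.ext_iff, funext_iff, funext_iff]
  refine forall_congr' fun v => ?_
  have hne : (T.childWeight a j v : ℂ) ≠ 0 := by exact_mod_cast (childWeight_pos ha j v).ne'
  change ContinuousLinearMap.adjoint (T.shift a j) f v = 0 ↔ _
  rw [adjoint_shift_apply, mul_eq_zero, or_iff_right hne, Pi.zero_apply]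

end ChildSum

section Support

lemma exists_forall_depth_le (j : Fin d) :
    ∃ N : ℕ, ∀ u v w, (T.tree j).Adj u v → (T.tree j).Adj u w → v ≠ w →
      (T.tree j).depth v ≤ N := by
  obtain ⟨N, hN⟩ := ENat.ne_top_iff_exists.1 (T.finite_branchingIndex j).ne
  exact ⟨N, fun u v w hv hw h => by exact_mod_cast hN ▸ depth_le_branchingIndex hv hw h⟩

variable {T}

lemma depth_le_of_childSum_eq_zero {j : Fin d} {f : T.Vert → ℂ} (hf : T.childSum j f = 0) {N : ℕ}
    (hN : ∀ u v w, (T.tree j).Adj u v → (T.tree j).Adj u w → v ≠ w → (T.tree j).depth v ≤ N)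
    {v : T.Vert} (hv : f v ≠ 0) : T.depth v j ≤ N := by
  by_contra! hlt
  have hroot : v j ≠ (T.tree j).root := fun h => by simp [depth, h, depth_root] at hlt
  have hadj : (T.tree j).Adj (T.par j v j) (v j) := by simpa [par] using adj_parent _ _ hroot
  refine hv ?_
  calc f v = T.childSum j f (T.par j v) := by
        rw [childSum_apply, Finset.sum_eq_single_of_mem (v j) (mem_childFinset.2 hadj), update_par]
        intro y hy hne
        exact absurd (hN _ _ _ hadj (mem_childFinset.1 hy) hne.symm) hlt.not_ge
    _ = 0 := congrFun hf _

variable (T)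

lemma finite_setOf_ne_zero (ha : 0 < a) : {v : T.Vert | ∃ f : T.E a, (f : T.L2) v ≠ 0}.Finite := by
  choose N hN using T.exists_forall_depth_le
  refine (Set.Finite.pi' fun j => finite_setOf_depth_le (T.locallyFinite j) (N j)).subset ?_
  rintro v ⟨f, hv⟩ j
  exact depth_le_of_childSum_eq_zero ((mem_E_iff ha).1 f.2 j) (hN j) hv

lemma finiteDimensional_E (ha : 0 < a) : FiniteDimensional ℂ (T.E a) := by
  have := (T.finite_setOf_ne_zero ha).to_subtype
  let values : T.E a →ₗ[ℂ] {v : T.Vert | ∃ f : T.E a, (f : T.L2) v ≠ 0} → ℂ :=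
    { toFun := fun f v => (f : T.L2) v
      map_add' := fun f g => rfl
      map_smul' := fun c f => rfl }
  refine FiniteDimensional.of_injective values ((injective_iff_map_eq_zero _).2 fun f hf => ?_)
  ext v
  by_contra hv
  exact hv (congrFun hf ⟨v, f, hv⟩)

end Support

section Restriction

/-- A set of vertices is sibling closed if, with a vertex, it contains all the vertices that are
obtained when one of the coordinates is replaced by a sibling. -/
def SiblingClosed (s : Set T.Vert) : Prop :=
  ∀ j (v : T.Vert), ∀ y ∈ T.childFinset j (v j), ∀ y' ∈ T.childFinset j (v j),
    Function.update v j y ∈ s → Function.update v j y' ∈ s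

variable {T}

lemma SiblingClosed.childSum_indicator {s : Set T.Vert} (hs : T.SiblingClosed s) {j : Fin d}
    {f : T.Vert → ℂ} (hf : T.childSum j f = 0) : T.childSum j (s.indicator f) = 0 := by
  funext v
  rw [childSum_apply]
  by_cases h : ∃ y ∈ T.childFinset j (v j), Function.update v j y ∈ s
  · obtain ⟨y, hy, hys⟩ := h
    rw [Finset.sum_congr rfl fun y' hy' => Set.indicator_of_mem (hs j v y hy y' hy' hys) f]
    exact congrFun hf v
  · exact Finset.sum_eq_zero fun y hy => Set.indicator_of_notMem (fun hys => h ⟨y, hy, hys⟩) f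

lemma SiblingClosed.exists_restriction (ha : 0 < a) {s : Set T.Vert} (hs : T.SiblingClosed s)
    (f : T.E a) : ∃ g : T.E a, ∀ v, (g : T.L2) v = s.indicator (f : T.L2) v := by
  have hfin : {v | s.indicator (f : T.L2) v ≠ 0}.Finite :=
    (T.finite_setOf_ne_zero ha).subset fun v hv => ⟨f, fun h => hv (by simp [Set.indicator, h])⟩
  let g : T.L2 := ⟨s.indicator (f : T.L2), (memℓp_zero hfin).of_exponent_ge zero_le⟩
  exact ⟨⟨g, (mem_E_iff ha).2 fun j => hs.childSum_indicator ((mem_E_iff ha).1 f.2 j)⟩,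
    fun v => rfl⟩

lemma inner_eq_zero_of_forall {f g : T.L2} (h : ∀ v, f v = 0 ∨ g v = 0) : ⟪f, g⟫_ℂ = 0 := by
  rw [lp.inner_eq_tsum]
  exact (tsum_congr fun v => by rcases h v with h | h <;> simp [h]).trans tsum_zero

end Restriction

end TreeProduct

/-! ### The kernel -/

namespace TreeProduct

section Kernel

variable {d : ℕ} {T : TreeProduct d} {a : ℕ} {F G : Finset (Fin d)} {u u' v : T.Vert}

lemma eq_of_mem_Phi (hF : v ∈ T.Phi F) (hG : v ∈ T.Phi G) : F = G := by
  ext j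
  rw [← hF j, ← hG j]

lemma Omega_subset_Phi : T.Omega F ⊆ T.Phi F := by
  rintro _ ⟨q, rfl⟩
  exact (Quotient.out q).2

lemma eq_of_mem_sib (hu : u ∈ T.Omega F) (hu' : u' ∈ T.Omega F) (h : v ∈ T.sib F u)
    (h' : v ∈ T.sib F u') : u = u' := by
  obtain ⟨q, rfl⟩ := hu
  obtain ⟨q', rfl⟩ := hu'
  have : q = q' := by
    rw [← Quotient.out_equiv_out (s := T.sibSetoid F)]
    exact ⟨(Quotient.out q).2, fun j hj => (h.2 j hj).symm.trans (h'.2 j hj)⟩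
  rw [this]

lemma exists_mem_Omega (hv : v ∈ T.Phi F) : ∃ u ∈ T.Omega F, v ∈ T.sib F u :=
  ⟨_, ⟨Quotient.mk (T.sibSetoid F) ⟨v, hv⟩, rfl⟩,
    (T.sibSetoid F).symm (Quotient.mk_out (s := T.sibSetoid F) ⟨v, hv⟩)⟩

lemma exists_mem_Phi (v : T.Vert) : ∃ F, v ∈ T.Phi F := by
  classical
  exact ⟨Finset.univ.filter fun j => v j ≠ (T.tree j).root, fun j => by simp⟩

lemma depth_eq_of_mem_sib (hu : u ∈ T.Phi F) (hv : v ∈ T.sib F u) : T.depth v = T.depth u := by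
  funext j
  by_cases hj : j ∈ F
  · rw [depth, depth, ← depth_parent_add_one ((hv.1 j).2 hj), hv.2 j hj,
      depth_parent_add_one ((hu j).2 hj)]
  · rw [depth, depth, not_not.1 (mt (hv.1 j).1 hj), not_not.1 (mt (hu j).1 hj)]

lemma siblingClosed_sib (F : Finset (Fin d)) (u : T.Vert) : T.SiblingClosed (T.sib F u) := by
  intro j v y hy y' hy' hmem
  have hy := mem_childFinset.1 hy
  have hy' := mem_childFinset.1 hy'
  refine ⟨fun i => ?_, fun i hi => ?_⟩
  · rw [← hmem.1 i]
    rcases eq_or_ne i j with rfl | hij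
    · simp [hy.ne_root, hy'.ne_root]
    · simp [hij]
  · rw [← hmem.2 i hi]
    rcases eq_or_ne i j with rfl | hij
    · simp [hy.parent_eq, hy'.parent_eq]
    · simp [hij]

lemma mem_L_of_support (ha : 0 < a) {f : T.E a} (hf : ∀ w, w ∉ T.sib F u → (f : T.L2) w = 0) :
    f ∈ T.L a F u := by
  refine ⟨hf, fun j _ v _ => ?_⟩
  set p := (T.tree j).parent (u j)
  have hsum := congrFun ((mem_E_iff ha).1 f.2 j) (Function.update v j p)
  simp only [childSum_apply, Function.update_self, Function.update_idem, Pi.zero_apply] at hsum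
  calc ∑ η ∈ T.childFinset j p, (f : T.L2) (Function.update v j η) *
        (T.weight a j (Function.update v j η) : ℂ)
      = ∑ η ∈ T.childFinset j p, (f : T.L2) (Function.update v j η) *
          (T.childWeight a j (Function.update v j p) : ℂ) := by
        refine Finset.sum_congr rfl fun η hη => ?_
        have hadj : (T.tree j).Adj (Function.update v j p j) η := by
          simpa using mem_childFinset.1 hη
        rw [← weight_update hadj, Function.update_idem]
    _ = 0 := by rw [← Finset.sum_mul, hsum, zero_mul]

lemma starProjection_L_apply (ha : 0 < a) (x : T.E a) (v : T.Vert) :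
    ((T.L a F u).starProjection x : T.L2) v = (T.sib F u).indicator (x : T.L2) v := by
  obtain ⟨g, hg⟩ := (siblingClosed_sib F u).exists_restriction ha x
  have hproj : (T.L a F u).starProjection x = g := by
    refine Submodule.eq_starProjection_of_mem_of_inner_eq_zero
      (mem_L_of_support ha fun w hw => ?_) fun f hf => ?_
    · rw [hg, Set.indicator_of_notMem hw]
    · refine inner_eq_zero_of_forall fun w => ?_
      by_cases hw : w ∈ T.sib F u
      · left
        simp [hg, hw]
      · exact Or.inr (hf.1 w hw)
  rw [hproj, hg]

lemma finite_setOf_starProjection_L_ne_zero (ha : 0 < a) :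
    {u : T.Omega F | (T.L a F u).starProjection ≠ 0}.Finite := by
  have hsupp : ∀ u : T.Omega F, (T.L a F u).starProjection ≠ 0 →
      ∃ v ∈ T.sib F u, ∃ f : T.E a, (f : T.L2) v ≠ 0 := by
    intro u hu
    contrapose! hu
    ext x v
    refine (starProjection_L_apply ha x v).trans (Set.indicator_apply_eq_zero.2 fun hv => ?_)
    exact hu v hv x
  have : Nonempty T.Vert := ⟨fun j => (T.tree j).root⟩
  choose! w hw hw' using hsupp
  have hinj : Set.InjOn w {u | (T.L a F u).starProjection ≠ 0} := fun u hu u' hu' h =>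
    Subtype.ext (eq_of_mem_sib u.2 u'.2 (hw u hu) (h ▸ hw u' hu'))
  refine Set.Finite.of_finite_image ((T.finite_setOf_ne_zero ha).subset ?_) hinj
  rintro _ ⟨u, hu, rfl⟩
  exact hw' u hu

lemma tsum_Omega_apply (ha : 0 < a) (c : T.Vert → ℂ) (x : T.E a) (v : T.Vert) :
    (((∑' u : T.Omega F, c u • (T.L a F u).starProjection) x : T.E a) : T.L2) v =
      ∑' u : T.Omega F, c u * (T.sib F u).indicator (x : T.L2) v := by
  have hsum : Summable fun u : T.Omega F => c u • (T.L a F u).starProjection :=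
    summable_of_hasFiniteSupport <| (finite_setOf_starProjection_L_ne_zero ha).subset
      fun u hu h => hu (by simp [h])
  let evalAt : (T.E a →L[ℂ] T.E a) →L[ℂ] ℂ :=
    (lp.evalCLM ℂ (fun _ : T.Vert => ℂ) 2 v ∘L (T.E a).subtypeL) ∘L
      ContinuousLinearMap.apply ℂ (T.E a) x
  refine (evalAt.map_tsum hsum).trans (tsum_congr fun u => ?_)
  rw [← starProjection_L_apply ha]
  rfl

lemma kernel_apply_apply (ha : 0 < a) (z w : UnitBall d) (x : T.E a) (v : T.Vert) :
    ((T.kernel a z w x : T.E a) : T.L2) v =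
      scalarKernel a (T.depth v) z w * (x : T.L2) v := by
  obtain ⟨F, hF⟩ := exists_mem_Phi v
  obtain ⟨u, hu, hv⟩ := exists_mem_Omega hF
  have hcoe : ∀ A : Finset (Fin d) → T.E a →L[ℂ] T.E a,
      (((∑ G, A G) x : T.E a) : T.L2) v = ∑ G, ((A G x : T.E a) : T.L2) v := fun A => by
    rw [sum_apply, Submodule.coe_sum, lp.coeFn_sum, Finset.sum_apply]
  simp only [kernel, Matrix.of_apply, hcoe]
  simp only [tsum_Omega_apply ha (fun u => scalarKernel a (T.depth u) z w)]
  rw [Finset.sum_eq_single_of_mem F (Finset.mem_univ F), tsum_eq_single ⟨u, hu⟩,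
    Set.indicator_of_mem hv, depth_eq_of_mem_sib (Omega_subset_Phi hu) hv]
  · intro u' hu'
    rw [Set.indicator_of_notMem, mul_zero]
    exact fun hv' => hu' (Subtype.ext (eq_of_mem_sib u'.2 hu hv' hv))
  · intro G _ hG
    refine (tsum_congr fun u' => ?_).trans tsum_zero
    rw [Set.indicator_of_notMem, mul_zero]
    exact fun hv' => hG (eq_of_mem_Phi hv'.1 hF)

end Kernel

end TreeProduct

/-! ### The Hilbert function -/

namespace TreeProduct

section HilbertFunction

variable {d : ℕ} (T : TreeProduct d) {a : ℕ}

/-- The subspace of the joint cokernel `E` that consists of the functions supported on the vertices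
of depth `δ`. -/
def homogeneous (a : ℕ) (δ : Fin d → ℕ) : Submodule ℂ (T.E a) where
  carrier := {f | ∀ v, T.depth v ≠ δ → (f : T.L2) v = 0}
  zero_mem' := by simp
  add_mem' := fun {f g} hf hg v hv => by simp [hf v hv, hg v hv]
  smul_mem' := fun c f hf v hv => by simp [hf v hv]

/-- The Hilbert function of the joint cokernel `E`, graded by the depth. -/
def hilbertFunction (a : ℕ) (δ : Fin d → ℕ) : ℕ := Module.finrank ℂ (T.homogeneous a δ)

variable {T}

lemma siblingClosed_setOf_depth_eq (δ : Fin d → ℕ) : T.SiblingClosed {v | T.depth v = δ} := by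
  intro j v y hy y' hy' h
  rw [Set.mem_ofPred_eq, depth_update (mem_childFinset.1 hy)] at h
  rw [Set.mem_ofPred_eq, depth_update (mem_childFinset.1 hy'), h]

lemma kernel_apply_of_mem_homogeneous (ha : 0 < a) {δ : Fin d → ℕ} {f : T.E a}
    (hf : f ∈ T.homogeneous a δ) (z w : UnitBall d) :
    T.kernel a z w f = scalarKernel a δ z w • f := by
  ext v
  refine (kernel_apply_apply ha z w f v).trans ?_
  change _ = scalarKernel a δ z w * (f : T.L2) v
  rcases eq_or_ne (T.depth v) δ with hv | hv
  · rw [hv]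
  · rw [hf v hv, mul_zero, mul_zero]

lemma inner_eq_zero_of_mem_homogeneous {δ δ' : Fin d → ℕ} (hne : δ ≠ δ') {f g : T.E a}
    (hf : f ∈ T.homogeneous a δ) (hg : g ∈ T.homogeneous a δ') : ⟪f, g⟫_ℂ = 0 := by
  refine inner_eq_zero_of_forall fun v => ?_
  by_cases hv : T.depth v = δ
  · exact Or.inr (hg v (hv ▸ hne))
  · exact Or.inl (hf v hv)

lemma eq_zero_of_forall_homogeneous (ha : 0 < a) {x : T.E a}
    (hx : ∀ δ, ∀ f ∈ T.homogeneous a δ, ⟪f, x⟫_ℂ = 0) : x = 0 := by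
  ext v
  obtain ⟨g, hg⟩ := (siblingClosed_setOf_depth_eq (T.depth v)).exists_restriction ha x
  have hmem : g ∈ T.homogeneous a (T.depth v) := fun w hw => by
    rw [hg, Set.indicator_of_notMem]
    exact hw
  have horth : ⟪g, x - g⟫_ℂ = 0 := by
    refine inner_eq_zero_of_forall fun w => ?_
    by_cases hw : T.depth w = T.depth v
    · right
      change (x : T.L2) w - (g : T.L2) w = 0
      rw [hg, Set.indicator_of_mem (show w ∈ {w | T.depth w = T.depth v} from hw), sub_self]
    · exact Or.inl (hmem w hw)
  have hzero : g = 0 := by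
    rwa [inner_sub_right, hx _ g hmem, zero_sub, neg_eq_zero, inner_self_eq_zero] at horth
  calc (x : T.L2) v = (g : T.L2) v := by
        rw [hg, Set.indicator_of_mem (show v ∈ {w | T.depth w = T.depth v} from rfl)]
    _ = 0 := by rw [hzero]; rfl

variable (T)

/-- The index set of a basis of `E` adapted to the depth: over each `δ` as many indices as the
dimension of the homogeneous part of depth `δ`. -/
abbrev BasisIndex (a : ℕ) : Type := Σ δ : Fin d → ℕ, Fin (T.hilbertFunction a δ)

/-- The union of orthonormal bases of the homogeneous parts of `E`. -/
def homogeneousFrame [FiniteDimensional ℂ (T.E a)] (i : T.BasisIndex a) : T.E a :=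
  stdOrthonormalBasis ℂ (T.homogeneous a i.1) i.2

lemma orthonormal_homogeneousFrame [FiniteDimensional ℂ (T.E a)] :
    Orthonormal ℂ (T.homogeneousFrame (a := a)) := by
  refine ⟨fun i => (stdOrthonormalBasis ℂ (T.homogeneous a i.1)).norm_eq_one i.2, ?_⟩
  rintro ⟨δ, i⟩ ⟨δ', i'⟩ hne
  rcases eq_or_ne δ δ' with rfl | hδ
  · exact (stdOrthonormalBasis ℂ (T.homogeneous a δ)).inner_eq_zero fun h =>
      hne (congrArg _ h)
  · exact inner_eq_zero_of_mem_homogeneous hδ (Subtype.prop _) (Subtype.prop _)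

lemma orthogonal_span_homogeneousFrame [FiniteDimensional ℂ (T.E a)] (ha : 0 < a) :
    (Submodule.span ℂ (Set.range (T.homogeneousFrame (a := a))))ᗮ = ⊥ := by
  refine (Submodule.eq_bot_iff _).2 fun x hx => eq_zero_of_forall_homogeneous ha fun δ f hf => ?_
  let e := stdOrthonormalBasis ℂ (T.homogeneous a δ)
  have hmem : f ∈ Submodule.span ℂ (Set.range (T.homogeneousFrame (a := a))) := by
    have hsum := congrArg Subtype.val (e.sum_repr' ⟨f, hf⟩)
    rw [Submodule.coe_sum] at hsum
    rw [← show _ = f from hsum]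
    exact Submodule.sum_mem _ fun i _ =>
      Submodule.smul_mem _ _ (Submodule.subset_span ⟨⟨δ, i⟩, rfl⟩)
  exact hx f hmem

lemma exists_orthonormalBasis_kernel_apply (ha : 0 < a) : ∃ (_ : Fintype (T.BasisIndex a))
    (b : OrthonormalBasis (T.BasisIndex a) ℂ (T.E a)),
    ∀ z w i, T.kernel a z w (b i) = scalarKernel a i.1 z w • b i := by
  have := T.finiteDimensional_E ha
  have hon := T.orthonormal_homogeneousFrame (a := a)
  have := hon.linearIndependent.finite
  let inst := Fintype.ofFinite (T.BasisIndex a)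
  let b := OrthonormalBasis.mkOfOrthogonalEqBot hon (T.orthogonal_span_homogeneousFrame ha)
  refine ⟨inst, b, fun z w i => ?_⟩
  rw [OrthonormalBasis.coe_of_orthogonal_eq_bot_mk]
  exact kernel_apply_of_mem_homogeneous ha
    (stdOrthonormalBasis ℂ (T.homogeneous a i.1) i.2).2 z w

/-- The Hilbert module of `T`, realized on the model space of an orthonormal basis of `E` that
diagonalizes the kernel. -/
def hilbertModule (ha : 0 < a) : HilbertModule a T :=
  letI := (T.exists_orthonormalBasis_kernel_apply ha).choose
  diagonalModule ha (T.exists_orthonormalBasis_kernel_apply ha).choose_spec.choose (fun i => i.1)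
    (T.exists_orthonormalBasis_kernel_apply ha).choose_spec.choose_spec

variable {T}

lemma hilbertModule_iso {T' : TreeProduct d} (ha : 0 < a)
    (h : T.hilbertFunction a = T'.hilbertFunction a) :
    (T.hilbertModule ha).Iso (T'.hilbertModule ha) :=
  letI := (T.exists_orthonormalBasis_kernel_apply ha).choose
  letI := (T'.exists_orthonormalBasis_kernel_apply ha).choose
  diagonalModule_iso ha _ _ (Equiv.sigmaCongrRight fun δ => finCongr (congrFun h δ)) fun _ => rfl

variable (T)

lemma finrank_jointCokernel_hilbertModule (ha : 0 < a) :
    Module.finrank ℂ (jointCokernel (T.hilbertModule ha).M) = Module.finrank ℂ (T.E a) := by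
  let inst := (T.exists_orthonormalBasis_kernel_apply ha).choose
  let b := (T.exists_orthonormalBasis_kernel_apply ha).choose_spec.choose
  rw [Module.finrank_eq_card_basis b.toBasis]
  exact finrank_jointCokernel_mulCoord ha _

end HilbertFunction

end TreeProduct

/-! ### Computation of the Hilbert function -/

open Module

/-- The increments of the sizes of the generations of a tree, starting with the size `1` of the
generation of the root. -/
def RootedDirectedTree.growth (T : RootedDirectedTree) : ℕ → ℤ
  | 0 => (T.generation 0).ncard
  | n + 1 => (T.generation (n + 1)).ncard - (T.generation n).ncard

lemma RootedDirectedTree.sum_growth (T : RootedDirectedTree) (n : ℕ) :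
    ∑ m ∈ Finset.range (n + 1), T.growth m = (T.generation n).ncard := by
  rw [Finset.sum_range_succ']
  simp only [growth]
  rw [Finset.sum_range_sub (fun m => ((T.generation m).ncard : ℤ)), sub_add_cancel]

lemma finrank_map_add_finrank_inf_ker {K V V' : Type*} [DivisionRing K] [AddCommGroup V]
    [Module K V] [AddCommGroup V'] [Module K V'] (f : V →ₗ[K] V') (W : Submodule K V)
    [FiniteDimensional K W] : finrank K (W.map f) + finrank K (W ⊓ f.ker : Submodule K V) =
      finrank K W := by
  rw [← LinearMap.range_domRestrict, ← Submodule.map_comap_subtype,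
    Submodule.finrank_map_subtype_eq, ← LinearMap.ker_domRestrict,
    LinearMap.finrank_range_add_finrank_ker]

lemma prod_add_single_of_notMem {ι M : Type*} [DecidableEq ι] [CommMonoid M] (f : ι → ℕ → M)
    (δ : ι → ℕ) {k : ι} {s : Finset ι} (hk : k ∉ s) :
    ∏ j ∈ s, f j ((δ + Pi.single k 1 : ι → ℕ) j) = ∏ j ∈ s, f j (δ j) :=
  Finset.prod_congr rfl fun j hj => by
    have hne : j ≠ k := ne_of_mem_of_not_mem hj hk
    rw [Pi.add_apply, Pi.single_eq_of_ne hne, add_zero]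

namespace TreeProduct

section Spread

variable {d : ℕ} {T : TreeProduct d}

open scoped Classical in
/-- A right inverse of `childSum k`: the value at `v` is distributed evenly over `Chi_k(v)`. -/
def spread (k : Fin d) (f : T.Vert → ℂ) (w : T.Vert) : ℂ :=
  if w k = (T.tree k).root then 0 else f (T.par k w) / (T.childFinset k (T.par k w k)).card

lemma childSum_spread (k : Fin d) (f : T.Vert → ℂ) : T.childSum k (spread k f) = f := by
  funext v
  have hcard : ((T.childFinset k (v k)).card : ℂ) ≠ 0 := by
    exact_mod_cast (card_childFinset_pos k (v k)).ne'
  calc T.childSum k (spread k f) v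
      = ∑ _y ∈ T.childFinset k (v k), f v / (T.childFinset k (v k)).card := by
        refine Finset.sum_congr rfl fun y hy => ?_
        have hy := mem_childFinset.1 hy
        rw [spread, Function.update_self, if_neg hy.ne_root, par_update hy]
    _ = f v := by rw [Finset.sum_const, nsmul_eq_mul, mul_div_cancel₀ _ hcard]

lemma par_update_of_ne {j k : Fin d} (h : j ≠ k) (v : T.Vert) (y : (T.tree j).V) :
    T.par k (Function.update v j y) = Function.update (T.par k v) j y := by
  rw [par, Function.update_of_ne h.symm, Function.update_comm h, par]

lemma childSum_spread_of_ne {j k : Fin d} (h : j ≠ k) (f : T.Vert → ℂ) :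
    T.childSum j (spread k f) = spread k (T.childSum j f) := by
  funext v
  have hroot (y : (T.tree j).V) : Function.update v j y k = v k := Function.update_of_ne h.symm y v
  rw [childSum_apply, spread, childSum_apply, par, Function.update_of_ne h]
  split_ifs with hv
  · refine Finset.sum_eq_zero fun y _ => ?_
    rw [spread, if_pos (by rw [hroot, hv])]
  · rw [Finset.sum_div]
    refine Finset.sum_congr rfl fun y _ => ?_
    rw [spread, if_neg (by rwa [hroot]), par_update_of_ne h, Function.update_of_ne h.symm, par]

lemma childSum_comm (j k : Fin d) (f : T.Vert → ℂ) :
    T.childSum j (T.childSum k f) = T.childSum k (T.childSum j f) := by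
  rcases eq_or_ne j k with rfl | h
  · rfl
  funext v
  simp only [childSum_apply, Function.update_of_ne h, Function.update_of_ne h.symm]
  rw [Finset.sum_comm]
  simp only [Function.update_comm h]

end Spread

section Harmonic

variable {d : ℕ} (T : TreeProduct d)

/-- The functions supported on the vertices of depth `δ` whose sums over the sets `Chi_j(v)` vanish
for all `j ∈ F`. -/
def harmonic (δ : Fin d → ℕ) (F : Finset (Fin d)) : Submodule ℂ (T.Vert → ℂ) where
  carrier := {f | (∀ v, T.depth v ≠ δ → f v = 0) ∧ ∀ j ∈ F, T.childSum j f = 0}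
  zero_mem' := ⟨fun _ _ => rfl, fun _ _ => map_zero _⟩
  add_mem' := fun {f g} hf hg =>
    ⟨fun v hv => by simp [hf.1 v hv, hg.1 v hv], fun j hj => by simp [hf.2 j hj, hg.2 j hj]⟩
  smul_mem' := fun c f hf =>
    ⟨fun v hv => by simp [hf.1 v hv], fun j hj => by simp [hf.2 j hj]⟩

variable {T} {δ : Fin d → ℕ} {F : Finset (Fin d)}

lemma setOf_depth_eq (δ : Fin d → ℕ) :
    {v | T.depth v = δ} = Set.univ.pi fun j => (T.tree j).generation (δ j) := by
  ext v
  simp [funext_iff, depth, mem_generation_iff]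

variable (T) in
lemma finite_setOf_depth_eq (δ : Fin d → ℕ) : {v | T.depth v = δ}.Finite := by
  rw [setOf_depth_eq]
  exact Set.Finite.pi fun j => finite_generation (T.locallyFinite j) (δ j)

lemma harmonic_empty_eq_range (δ : Fin d → ℕ) : T.harmonic δ ∅ =
    (Function.ExtendByZero.linearMap ℂ (Subtype.val : {v | T.depth v = δ} → T.Vert)).range := by
  have hextend (g : {v | T.depth v = δ} → ℂ) {v : T.Vert} (hv : T.depth v ≠ δ) :
      Function.extend Subtype.val g 0 v = 0 :=
    Function.extend_apply' _ _ _ (by rintro ⟨w, rfl⟩; exact hv w.2)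
  ext f
  refine ⟨fun hf => ⟨fun v => f v, funext fun v => ?_⟩, ?_⟩
  · by_cases hv : T.depth v = δ
    · exact Subtype.val_injective.extend_apply (fun v : {v | T.depth v = δ} => f v) 0 ⟨v, hv⟩
    · exact (hextend (fun v => f v) hv).trans (hf.1 v hv).symm
  · rintro ⟨g, rfl⟩
    exact ⟨fun v hv => hextend g hv, by simp⟩

instance finiteDimensional_harmonic : FiniteDimensional ℂ (T.harmonic δ F) := by
  have := (T.finite_setOf_depth_eq δ).to_subtype
  have : FiniteDimensional ℂ (T.harmonic δ ∅) := by
    rw [harmonic_empty_eq_range]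
    infer_instance
  exact Submodule.finiteDimensional_of_le (S₂ := T.harmonic δ ∅) fun f hf => ⟨hf.1, by simp⟩

lemma finrank_harmonic_empty (δ : Fin d → ℕ) :
    finrank ℂ (T.harmonic δ ∅) = ∏ j, ((T.tree j).generation (δ j)).ncard := by
  have := (T.finite_setOf_depth_eq δ).fintype
  have hinj : Function.Injective
      (Function.ExtendByZero.linearMap ℂ (Subtype.val : {v | T.depth v = δ} → T.Vert)) :=
    Function.extend_injective Subtype.val_injective _
  calc finrank ℂ (T.harmonic δ ∅) = Nat.card {v | T.depth v = δ} := by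
        rw [harmonic_empty_eq_range, LinearMap.finrank_range_of_inj hinj,
          finrank_fintype_fun_eq_card, Nat.card_eq_fintype_card]
    _ = ∏ j, ((T.tree j).generation (δ j)).ncard := by
        rw [setOf_depth_eq, Nat.card_congr (Equiv.Set.univPi _), Nat.card_pi]
        rfl

lemma harmonic_insert (k : Fin d) : T.harmonic δ (insert k F) =
    T.harmonic δ F ⊓ (T.childSum k).ker := by
  ext f
  change _ ∧ _ ↔ (_ ∧ _) ∧ T.childSum k f = 0
  rw [Finset.forall_mem_insert]
  tauto

lemma harmonic_insert_of_eq_zero {k : Fin d} (hk : δ k = 0) :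
    T.harmonic δ (insert k F) = T.harmonic δ F := by
  rw [harmonic_insert, inf_eq_left]
  refine fun f hf => funext fun v => Finset.sum_eq_zero fun y hy => hf.1 _ fun h => ?_
  rw [depth_update (mem_childFinset.1 hy)] at h
  simp [← h] at hk

lemma map_childSum_harmonic {k : Fin d} (hk : k ∉ F) :
    (T.harmonic (δ + Pi.single k 1) F).map (T.childSum k) = T.harmonic δ F := by
  ext h
  constructor
  · rintro ⟨f, hf, rfl⟩
    refine ⟨fun v hv => Finset.sum_eq_zero fun y hy => hf.1 _ ?_, fun j hj => ?_⟩
    · rwa [depth_update (mem_childFinset.1 hy), Ne, add_left_inj]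
    · rw [childSum_comm, hf.2 j hj, map_zero]
  · refine fun hh => ⟨spread k h, ⟨fun w hw => ?_, fun j hj => ?_⟩, childSum_spread k h⟩
    · rw [spread]
      split_ifs with hroot
      · rfl
      have hadj : (T.tree k).Adj (T.par k w k) (w k) := by simpa [par] using adj_parent _ _ hroot
      rw [hh.1, zero_div]
      contrapose! hw
      rw [← update_par k w, depth_update hadj, hw]
    · have hne : j ≠ k := fun e => hk (e ▸ hj)
      rw [childSum_spread_of_ne hne, hh.2 j hj]
      funext w
      simp [spread]

lemma finrank_harmonic_insert_add_single {k : Fin d} (hk : k ∉ F) :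
    finrank ℂ (T.harmonic δ F) + finrank ℂ (T.harmonic (δ + Pi.single k 1) (insert k F)) =
      finrank ℂ (T.harmonic (δ + Pi.single k 1) F) := by
  rw [← map_childSum_harmonic hk, harmonic_insert, finrank_map_add_finrank_inf_ker]

lemma finrank_harmonic (δ : Fin d → ℕ) (F : Finset (Fin d)) :
    (finrank ℂ (T.harmonic δ F) : ℤ) =
      (∏ j ∈ F, (T.tree j).growth (δ j)) * ∏ j ∈ Fᶜ, (((T.tree j).generation (δ j)).ncard : ℤ) := by
  induction F using Finset.induction generalizing δ with
  | empty => simp [finrank_harmonic_empty]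
  | insert k F hk ih =>
    have hsplit (δ : Fin d → ℕ) : ∏ j ∈ Fᶜ, (((T.tree j).generation (δ j)).ncard : ℤ) =
        ((T.tree k).generation (δ k)).ncard *
          ∏ j ∈ (insert k F)ᶜ, (((T.tree j).generation (δ j)).ncard : ℤ) := by
      rw [Finset.compl_insert, Finset.mul_prod_erase Fᶜ
        (fun j => (((T.tree j).generation (δ j)).ncard : ℤ)) (Finset.mem_compl.2 hk)]
    rw [Finset.prod_insert hk]
    rcases eq_or_ne (δ k) 0 with hδ | hδ
    · rw [harmonic_insert_of_eq_zero hδ, ih, hsplit, hδ, growth]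
      ring
    · obtain ⟨δ, rfl⟩ := exists_eq_add_single hδ
      have hF := prod_add_single_of_notMem (fun j => (T.tree j).growth) δ hk
      have hFc := prod_add_single_of_notMem
        (fun j n => (((T.tree j).generation n).ncard : ℤ)) δ (s := (insert k F)ᶜ) (k := k) (by simp)
      have hrank := congrArg (Nat.cast (R := ℤ))
        (finrank_harmonic_insert_add_single (T := T) (δ := δ) hk)
      rw [Nat.cast_add, ih, ih, hsplit, hsplit, hF, hFc, Pi.add_apply, Pi.single_eq_same] at hrank
      rw [hF, hFc, Pi.add_apply, Pi.single_eq_same, growth]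
      linear_combination hrank

lemma hilbertFunction_eq_finrank_harmonic {a : ℕ} (ha : 0 < a) (δ : Fin d → ℕ) :
    T.hilbertFunction a δ = finrank ℂ (T.harmonic δ Finset.univ) := by
  let toFun : T.homogeneous a δ →ₗ[ℂ] T.harmonic δ Finset.univ :=
    { toFun f := ⟨(f : T.E a), f.2, fun j _ => (mem_E_iff ha).1 (f : T.E a).2 j⟩
      map_add' _ _ := rfl
      map_smul' _ _ := rfl }
  refine (LinearEquiv.ofBijective toFun ⟨fun f g h => ?_, fun f => ?_⟩).finrank_eq
  · ext v
    exact congrFun (congrArg Subtype.val h) v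
  · have hfin : {v | (f : T.Vert → ℂ) v ≠ 0}.Finite :=
      (T.finite_setOf_depth_eq δ).subset fun v hv => not_imp_comm.1 (f.2.1 v) hv
    let g : T.L2 := ⟨f.1, (memℓp_zero hfin).of_exponent_ge zero_le⟩
    exact ⟨⟨⟨g, (mem_E_iff ha).2 fun j => f.2.2 j (Finset.mem_univ j)⟩, f.2.1⟩, rfl⟩

lemma hilbertFunction_eq_prod_growth {a : ℕ} (ha : 0 < a) (δ : Fin d → ℕ) :
    (T.hilbertFunction a δ : ℤ) = ∏ j, (T.tree j).growth (δ j) := by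
  rw [hilbertFunction_eq_finrank_harmonic ha, finrank_harmonic, Finset.compl_univ,
    Finset.prod_empty, mul_one]

lemma hilbertFunction_eq_of_ncard_generation_eq {a : ℕ} (ha : 0 < a) {T' : TreeProduct d}
    (h : ∀ j n, ((T.tree j).generation n).ncard = ((T'.tree j).generation n).ncard) :
    T.hilbertFunction a = T'.hilbertFunction a := by
  have hgrowth (j : Fin d) (n : ℕ) : (T.tree j).growth n = (T'.tree j).growth n := by
    cases n <;> simp only [growth, h]
  funext δ
  exact_mod_cast (hilbertFunction_eq_prod_growth ha δ).trans <|
    (Finset.prod_congr rfl fun j _ => hgrowth j (δ j)).trans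
      (hilbertFunction_eq_prod_growth ha δ).symm

lemma hilbertFunction_eq_zero {a : ℕ} (ha : 0 < a) {N : Fin d → ℕ}
    (hN : ∀ j u v w, (T.tree j).Adj u v → (T.tree j).Adj u w → v ≠ w → (T.tree j).depth v ≤ N j)
    {δ : Fin d → ℕ} (hδ : ¬ δ ≤ N) : T.hilbertFunction a δ = 0 := by
  have hbot : T.homogeneous a δ = ⊥ := (Submodule.eq_bot_iff _).2 fun f hf => by
    ext v
    by_contra hv
    obtain rfl : T.depth v = δ := not_imp_comm.1 (hf v) hv
    exact hδ fun j => depth_le_of_childSum_eq_zero ((mem_E_iff ha).1 f.2 j) (hN j) hv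
  rw [hilbertFunction, hbot, finrank_bot]

lemma finrank_E_eq_sum_hilbertFunction {a : ℕ} (ha : 0 < a) {s : Finset (Fin d → ℕ)}
    (hs : ∀ δ ∉ s, T.hilbertFunction a δ = 0) :
    finrank ℂ (T.E a) = ∑ δ ∈ s, T.hilbertFunction a δ := by
  obtain ⟨inst, b, -⟩ := T.exists_orthonormalBasis_kernel_apply ha
  have huniv : (Finset.univ : Finset (T.BasisIndex a)) = s.sigma fun _ => Finset.univ := by
    ext ⟨δ, i⟩
    simp only [Finset.mem_univ, Finset.mem_sigma, and_true, true_iff]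
    by_contra hδ
    exact (hs δ hδ ▸ i).elim0
  rw [finrank_eq_card_basis b.toBasis, ← Finset.card_univ, huniv, Finset.card_sigma]
  simp only [Finset.card_univ, Fintype.card_fin]

lemma finrank_E {a : ℕ} (ha : 0 < a) {N : Fin d → ℕ}
    (hN : ∀ j u v w, (T.tree j).Adj u v → (T.tree j).Adj u w → v ≠ w →
      (T.tree j).depth v ≤ N j) :
    finrank ℂ (T.E a) = ∏ j, ((T.tree j).generation (N j)).ncard := by
  let s := Fintype.piFinset fun j => Finset.range (N j + 1)
  have hs : ∀ δ ∉ s, T.hilbertFunction a δ = 0 := fun δ hδ =>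
    hilbertFunction_eq_zero ha hN fun h =>
      hδ (Fintype.mem_piFinset.2 fun j => Finset.mem_range_succ_iff.2 (h j))
  have hsum : (finrank ℂ (T.E a) : ℤ) = ∏ j, (((T.tree j).generation (N j)).ncard : ℤ) :=
    calc (finrank ℂ (T.E a) : ℤ) = ∑ δ ∈ s, ∏ j, (T.tree j).growth (δ j) := by
          rw [finrank_E_eq_sum_hilbertFunction ha hs, Nat.cast_sum]
          exact Finset.sum_congr rfl fun δ _ => hilbertFunction_eq_prod_growth ha δ
      _ = ∏ j, ∑ n ∈ Finset.range (N j + 1), (T.tree j).growth n :=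
          (Finset.prod_univ_sum _ _).symm
      _ = ∏ j, (((T.tree j).generation (N j)).ncard : ℤ) :=
          Finset.prod_congr rfl fun j _ => (T.tree j).sum_growth (N j)
  exact_mod_cast hsum

end Harmonic

end TreeProduct

/-! ### Bushes -/

section OutDegree

lemma RootedDirectedTree.Adj.ne {T : RootedDirectedTree} {u v : T.V} (h : T.Adj u v) : u ≠ v :=
  fun e => (Nat.lt_succ_self (T.depth v)).ne (by simpa only [e] using h.depth_eq)

namespace TreeProduct

variable {d : ℕ}

/-- The number of children of a vertex of the product, an isomorphism invariant of the directed
graph. -/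
def outDegree (T : TreeProduct d) (v : T.Vert) : ℕ := {w | T.Adj v w}.ncard

lemma outDegree_eq_sum (T : TreeProduct d) (v : T.Vert) :
    T.outDegree v = ∑ j, ((T.tree j).children (v j)).ncard := by
  let toChild (y : Σ j, (T.tree j).children (v j)) : {w | T.Adj v w} :=
    ⟨Function.update v y.1 y.2, y.1, fun j hj => by rw [Function.update_of_ne hj], by
      rw [Function.update_self]; exact y.2.2⟩
  have hinj : Function.Injective toChild := by
    rintro ⟨j, y, hy⟩ ⟨k, z, hz⟩ h
    have h : Function.update v j y j = Function.update v k z j :=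
      congrFun (congrArg Subtype.val h) j
    rw [Function.update_self] at h
    obtain rfl | hjk := eq_or_ne j k
    · rw [Function.update_self] at h
      subst h
      rfl
    · rw [Function.update_of_ne hjk] at h
      exact absurd h.symm (Adj.ne hy)
  have hsurj : Function.Surjective toChild := by
    rintro ⟨w, k, hne, hk⟩
    exact ⟨⟨k, w k, hk⟩, Subtype.ext <| Function.update_eq_iff.2 ⟨rfl, hne⟩⟩
  have (j : Fin d) : Finite ((T.tree j).children (v j)) := T.locallyFinite j (v j)
  rw [outDegree, ← Nat.card_coe_set_eq,
    ← Nat.card_congr (Equiv.ofBijective toChild ⟨hinj, hsurj⟩), Nat.card_sigma]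
  simp only [Nat.card_coe_set_eq]

lemma GraphIso.range_outDegree_eq {T T' : TreeProduct d} (h : T.GraphIso T') :
    Set.range T.outDegree = Set.range T'.outDegree := by
  obtain ⟨φ⟩ := h
  have hφ (v : T.Vert) : T'.outDegree (φ v) = T.outDegree v := by
    have himage : {w | T'.Adj (φ v) w} = φ '' {w | T.Adj v w} := by
      ext w
      obtain ⟨w, rfl⟩ := φ.surjective w
      simp only [Set.mem_ofPred_eq, φ.map_rel_iff, φ.injective.mem_set_image]
    rw [outDegree, himage, Set.ncard_image_of_injective _ φ.injective, outDegree]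
  rw [← φ.surjective.range_comp T'.outDegree]
  exact congrArg Set.range (funext fun v => (hφ v).symm)

end TreeProduct

end OutDegree

variable {R Q : Type}

section Bush

/-- The vertices of the tree `bush c`. -/
inductive BushVert (R Q : Type)
  | root
  | mid (q : Q)
  | ray (r : R) (n : ℕ)

/-- The edges of the tree `bush c`. -/
inductive BushAdj (c : R → Q) : BushVert R Q → BushVert R Q → Prop
  | root_mid (q : Q) : BushAdj c .root (.mid q)
  | mid_ray (r : R) : BushAdj c (.mid (c r)) (.ray r 0)
  | ray_ray (r : R) (n : ℕ) : BushAdj c (.ray r n) (.ray r (n + 1))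

/-- The tree in which the children of the root are indexed by `Q`, and infinite unbranched rays,
indexed by `R`, are attached to them as prescribed by `c : R → Q`. The sizes of its generations
depend on the cardinalities of `R` and `Q` only, its out-degrees also on those of the fibres
of `c`. -/
def bush (c : R → Q) : RootedDirectedTree where
  V := BushVert R Q
  Adj := BushAdj c
  root := .root
  not_adj_root u h := nomatch h
  existsUnique_parent v hv := by
    rcases v with _ | q | ⟨r, _ | n⟩
    · exact absurd rfl hv
    · exact ⟨.root, .root_mid q, fun u h => by cases h; rfl⟩
    · exact ⟨.mid (c r), .mid_ray r, fun u h => by cases h; rfl⟩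
    · exact ⟨.ray r n, .ray_ray r n, fun u h => by cases h; rfl⟩
  reachable v := by
    have hmid (q : Q) : Relation.ReflTransGen (BushAdj c) .root (.mid q) := .single (.root_mid q)
    rcases v with _ | q | ⟨r, n⟩
    · exact .refl
    · exact hmid q
    · induction n with
      | zero => exact (hmid (c r)).tail (.mid_ray r)
      | succ n ih => exact ih.tail (.ray_ray r n)

variable {c : R → Q}

lemma children_bush_root : (bush c).children BushVert.root = Set.range (BushVert.mid (R := R)) := by
  ext v
  constructor
  · rintro ⟨q⟩
    exact ⟨q, rfl⟩
  · rintro ⟨q, rfl⟩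
    exact BushAdj.root_mid q

lemma children_bush_mid (q : Q) :
    (bush c).children (BushVert.mid q) = (fun r => BushVert.ray r 0) '' (c ⁻¹' {q}) := by
  ext v
  constructor
  · rintro ⟨⟩
    exact ⟨_, rfl, rfl⟩
  · rintro ⟨r, rfl, rfl⟩
    exact BushAdj.mid_ray r

lemma children_bush_ray (r : R) (n : ℕ) :
    (bush c).children (BushVert.ray r n) = {BushVert.ray r (n + 1)} := by
  ext v
  constructor
  · rintro ⟨⟩
    rfl
  · rintro rfl
    exact BushAdj.ray_ray r n

lemma injective_mid : Function.Injective (BushVert.mid : Q → BushVert R Q) :=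
  fun _ _ => BushVert.mid.inj

lemma injective_ray (n : ℕ) :
    Function.Injective (fun r => BushVert.ray r n : R → BushVert R Q) :=
  fun _ _ h => (BushVert.ray.inj h).1

lemma ncard_children_bush_root : ((bush c).children BushVert.root).ncard = Nat.card Q := by
  rw [children_bush_root]
  exact Set.ncard_range_of_injective injective_mid

lemma ncard_children_bush_mid (q : Q) :
    ((bush c).children (BushVert.mid q)).ncard = (c ⁻¹' {q}).ncard := by
  rw [children_bush_mid]
  exact Set.ncard_image_of_injective _ (injective_ray 0)

lemma ncard_children_bush_ray (r : R) (n : ℕ) :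
    ((bush c).children (BushVert.ray r n)).ncard = 1 := by
  rw [children_bush_ray]
  exact Set.ncard_singleton _

lemma generation_bush_one : (bush c).generation 1 = Set.range (BushVert.mid (R := R)) := by
  rw [← children_bush_root (c := c)]
  ext v
  exact exists_eq_left

lemma generation_bush_add_two (n : ℕ) :
    (bush c).generation (n + 2) = Set.range fun r => (BushVert.ray r n : BushVert R Q) := by
  induction n with
  | zero =>
    ext v
    constructor
    · rintro ⟨u, hu, h⟩
      rw [generation_bush_one] at hu
      obtain ⟨q, rfl⟩ := hu
      obtain ⟨⟩ : BushAdj c (.mid q) v := h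
      exact ⟨_, rfl⟩
    · rintro ⟨r, rfl⟩
      exact ⟨_, generation_bush_one (c := c) ▸ ⟨c r, rfl⟩, BushAdj.mid_ray r⟩
  | succ n ih =>
    ext v
    constructor
    · rintro ⟨u, hu, h⟩
      rw [ih] at hu
      obtain ⟨r, rfl⟩ := hu
      obtain ⟨⟩ : BushAdj c (.ray r n) v := h
      exact ⟨r, rfl⟩
    · rintro ⟨r, rfl⟩
      exact ⟨_, ih ▸ ⟨r, rfl⟩, BushAdj.ray_ray r n⟩

lemma ncard_generation_bush_add_two (n : ℕ) :
    ((bush c).generation (n + 2)).ncard = Nat.card R := by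
  rw [generation_bush_add_two]
  exact Set.ncard_range_of_injective (injective_ray n)

lemma ncard_generation_bush_eq (c c' : R → Q) :
    ∀ n, ((bush c).generation n).ncard = ((bush c').generation n).ncard
  | 0 => rfl
  | 1 => by rw [generation_bush_one, generation_bush_one]; rfl
  | n + 2 => by rw [ncard_generation_bush_add_two, ncard_generation_bush_add_two]

lemma branchingIndex_bush_le : (bush c).branchingIndex ≤ 2 := by
  refine iSup₂_le fun v hv => ?_
  have hroot : (bush c).depth BushVert.root = 0 := depth_root
  rcases v with _ | q | ⟨r, n⟩
  · rw [hroot]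
    norm_num
  · have h : (bush c).Adj BushVert.root (BushVert.mid q) := BushAdj.root_mid q
    rw [h.depth_eq, hroot]
    norm_num
  · have h : ((bush c).children (BushVert.ray r n)).Nontrivial := hv
    rw [children_bush_ray] at h
    exact absurd h Set.not_nontrivial_singleton

lemma countable_bushVert [Countable R] [Countable Q] : Countable (BushVert R Q) := by
  let code : BushVert R Q → Option (Q ⊕ R × ℕ)
    | .root => none
    | .mid q => some (.inl q)
    | .ray r n => some (.inr (r, n))
  refine Function.Injective.countable (f := code) ?_
  rintro (_ | q | ⟨r, n⟩) (_ | q' | ⟨r', n'⟩) h <;> cases h <;> rfl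

lemma infinite_bushVert [Nonempty R] : Infinite (BushVert R Q) :=
  Infinite.of_injective (fun n => BushVert.ray (Classical.arbitrary R) n)
    fun _ _ h => (BushVert.ray.inj h).2

lemma finite_children_bush [Finite R] [Finite Q] (v : (bush c).V) :
    ((bush c).children v).Finite := by
  rcases v with _ | q | ⟨r, n⟩
  · rw [children_bush_root]
    exact Set.finite_range _
  · rw [children_bush_mid]
    exact (Set.toFinite _).image _
  · rw [children_bush_ray]
    exact Set.finite_singleton _

lemma nonempty_children_bush [Nonempty R] (hc : c.Surjective) (v : (bush c).V) :
    ((bush c).children v).Nonempty := by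
  rcases v with _ | q | ⟨r, n⟩
  · exact ⟨_, BushAdj.root_mid (c (Classical.arbitrary R))⟩
  · obtain ⟨r, rfl⟩ := hc q
    exact ⟨_, BushAdj.mid_ray r⟩
  · exact ⟨_, BushAdj.ray_ray r n⟩

end Bush

section BushPower

variable [Finite R] [Nonempty R] [Finite Q]

/-- The directed Cartesian product of `d` copies of the tree `bush c`. -/
def bushPower (d : ℕ) (c : R → Q) (hc : c.Surjective) : TreeProduct d where
  tree _ := bush c
  countable _ := countable_bushVert
  infinite _ := infinite_bushVert
  leafless _ := nonempty_children_bush hc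
  locallyFinite _ := finite_children_bush
  finite_branchingIndex _ := branchingIndex_bush_le.trans_lt (ENat.natCast_lt_top 2)

variable {d : ℕ} {c c' : R → Q}

lemma finrank_E_bushPower {a : ℕ} (ha : 0 < a) (hc : c.Surjective) :
    finrank ℂ ((bushPower d c hc).E a) = Nat.card R ^ d := by
  have hN (j : Fin d) (u v w : ((bushPower d c hc).tree j).V)
      (hv : ((bushPower d c hc).tree j).Adj u v) (hw : ((bushPower d c hc).tree j).Adj u w)
      (hne : v ≠ w) : ((bushPower d c hc).tree j).depth v ≤ 2 := by
    exact_mod_cast (depth_le_branchingIndex hv hw hne).trans branchingIndex_bush_le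
  rw [TreeProduct.finrank_E ha (N := fun _ => 2) hN]
  exact (Finset.prod_congr rfl fun _ _ => ncard_generation_bush_add_two 0).trans (by simp)

lemma hilbertModule_bushPower_iso {a : ℕ} (ha : 0 < a) (hc : c.Surjective) (hc' : c'.Surjective) :
    ((bushPower d c hc).hilbertModule ha).Iso ((bushPower d c' hc').hilbertModule ha) :=
  TreeProduct.hilbertModule_iso ha <| TreeProduct.hilbertFunction_eq_of_ncard_generation_eq ha
    fun _ => ncard_generation_bush_eq c c'

lemma isGreatest_range_outDegree_bushPower (hc : c.Surjective) {m : ℕ} (hQ : Nat.card Q ≤ m)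
    (hm : IsGreatest (Set.range fun q => (c ⁻¹' {q}).ncard) m) :
    IsGreatest (Set.range (bushPower d c hc).outDegree) (d * m) := by
  have : Nonempty Q := Nonempty.map c inferInstance
  have hchildren (v : (bush c).V) : ((bush c).children v).ncard ≤ m := by
    rcases v with _ | q | ⟨r, n⟩
    · exact ncard_children_bush_root.trans_le hQ
    · exact (ncard_children_bush_mid q).trans_le (hm.2 ⟨q, rfl⟩)
    · exact (ncard_children_bush_ray r n).trans_le (Nat.card_pos.trans_le hQ)
  obtain ⟨⟨q, hq⟩, -⟩ := hm
  constructor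
  · refine ⟨fun _ => BushVert.mid q, (TreeProduct.outDegree_eq_sum _ _).trans ?_⟩
    exact (Finset.sum_congr rfl fun _ _ => (ncard_children_bush_mid q).trans hq).trans (by simp)
  · rintro _ ⟨v, rfl⟩
    rw [TreeProduct.outDegree_eq_sum]
    exact (Finset.sum_le_sum fun j _ => hchildren (v j)).trans (by simp)

lemma eq_of_graphIso_bushPower (hd : 0 < d) (hc : c.Surjective) (hc' : c'.Surjective) {m m' : ℕ}
    (hQ : Nat.card Q ≤ m) (hm : IsGreatest (Set.range fun q => (c ⁻¹' {q}).ncard) m)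
    (hQ' : Nat.card Q ≤ m') (hm' : IsGreatest (Set.range fun q => (c' ⁻¹' {q}).ncard) m')
    (h : (bushPower d c hc).GraphIso (bushPower d c' hc')) : m = m' := by
  have hgreatest := isGreatest_range_outDegree_bushPower (d := d) hc hQ hm
  rw [h.range_outDegree_eq] at hgreatest
  exact Nat.eq_of_mul_eq_mul_left hd <|
    hgreatest.unique (isGreatest_range_outDegree_bushPower hc' hQ' hm')

end BushPower

section Cut

variable {k : ℕ}

/-- The partition of `2 k + 1` points into the first `k + i + 1` and the last `k - i`. -/
def cut (i : Fin k) (r : Fin (2 * k + 1)) : Bool := (r : ℕ) ≤ k + i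

lemma surjective_cut (i : Fin k) : (cut i).Surjective := by
  rintro (_ | _)
  · exact ⟨Fin.last _, by simp [cut]; omega⟩
  · exact ⟨0, by simp [cut]⟩

lemma isGreatest_ncard_preimage_cut (i : Fin k) :
    IsGreatest (Set.range fun t => (cut i ⁻¹' {t}).ncard) (k + i + 1) := by
  have htrue : (cut i ⁻¹' {true}).ncard = k + i + 1 := by
    have hIic : cut i ⁻¹' {true} = Set.Iic ⟨k + i, by omega⟩ := by
      ext r
      simp [cut, Fin.le_def]
    rw [hIic, ← Finset.coe_Iic, Set.ncard_coe_finset, Fin.card_Iic]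
  have hfalse : (cut i ⁻¹' {false}).ncard = k - i := by
    have hcompl : cut i ⁻¹' {false} = (cut i ⁻¹' {true})ᶜ := by
      ext r
      simp
    rw [hcompl, Set.ncard_compl, htrue, Nat.card_fin]
    omega
  refine ⟨⟨true, htrue⟩, ?_⟩
  rintro _ ⟨_ | _, rfl⟩
  · exact hfalse.trans_le (by omega)
  · exact htrue.le

end Cut

end DruryArveson

end

open DruryArveson

theorem corollary1p7 (a d : ℕ) (ha : 0 < a) (hd : 0 < d) :
    (∃ (T : ℕ → DruryArveson.TreeProduct d) (X : ∀ n, DruryArveson.HilbertModule a (T n)),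
      ∀ m n, m ≠ n → ¬ (X m).Iso (X n)) ∧
    (∀ k : ℕ, 0 < k →
      ∃ (T : Fin k → DruryArveson.TreeProduct d) (X : ∀ i, DruryArveson.HilbertModule a (T i)),
        (∀ i j, i ≠ j → ¬ (T i).GraphIso (T j)) ∧ ∀ i j, (X i).Iso (X j)) := by
  constructor
  · have hsurj (n : ℕ) : Function.Surjective fun _ : Fin (n + 1) => () := fun _ => ⟨0, rfl⟩
    refine ⟨fun n => bushPower d _ (hsurj n), fun n => (bushPower d _ (hsurj n)).hilbertModule ha,
      fun m n hmn hiso => hmn ?_⟩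
    have hrank := hiso.finrank_jointCokernel_eq
    simp only [TreeProduct.finrank_jointCokernel_hilbertModule, finrank_E_bushPower ha,
      Nat.card_fin] at hrank
    exact Nat.succ_injective (Nat.pow_left_injective hd.ne' hrank)
  · intro k _
    have hcard (i : Fin k) : Nat.card Bool ≤ k + i + 1 := by
      rw [Nat.card_eq_fintype_card, Fintype.card_bool]
      omega
    refine ⟨fun i => bushPower d _ (surjective_cut i),
      fun i => (bushPower d _ (surjective_cut i)).hilbertModule ha, fun i j hij hiso => hij ?_,
      fun i j => hilbertModule_bushPower_iso ha _ _⟩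
    have hsize := eq_of_graphIso_bushPower hd _ _ (hcard i) (isGreatest_ncard_preimage_cut i)
      (hcard j) (isGreatest_ncard_preimage_cut j) hiso
    omega
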